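/- Let $\Gamma$ be a topological space homeomorphic to the circle $S^1$ (for instance a finite graph homeomorphic to $S^1$) and let $n\ge 1$. Let $\mathrm{Conf}(\Gamma,n)$ be the space of ordered $n$-tuples of pairwise distinct points of $\Gamma$, on which $\Sigma_n$ acts by $(x_1,\dots,x_n)\mapsto(x_{\sigma(1)},\dots,x_{\sigma(n)})$, and let $$\xi_{\Gamma,n}:\ \mathrm{Conf}(\Gamma,n)\times_{\Sigma_n}\mathbb{R}^n\to \mathrm{Conf}(\Gamma,n)/\Sigma_n$$ be the associated rank-$n$ real vector bundle, where $\Sigma_n$ permutes the coordinates of $\mathbb{R}^n$. For a vector bundle $\xi$, let $o(\xi)$ (respectively $s(\xi)$) be the smallest integer $m\ge 1$ such that the $m$-fold Whitney sum $\xi^{\oplus m}$ is trivial (respectively stably trivial, i.e. becomes trivial after adding a trivial bundle). Then: 1. $s(\xi_{\Gamma,n})=o(\xi_{\Gamma,n})$, and this number is $1$ if $n$ is odd and $2$ if $n$ is even. 2. Let $i:\mathbb{Z}/n\to\Sigma_n$ be the injective homomorphism sending $1$ to the $n$-cycle $(1\,2\,\cdots\,n)$. The structure group of the covering $\mathrm{Conf}(\Gamma,n)\to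 \mathrm{Conf}(\Gamma,n)/\Sigma_n$ reduces to $\mathbb{Z}/n$ along $i$ (there are local sections over an open cover which differ by the image under $i$ of a locally constant $\mathbb{Z}/n$-valued cocycle), and the structure group of the vector bundle $\xi_{\Gamma,n}$ reduces to the discrete group $\mathbb{Z}/n$ along $\mathbb{Z}/n\xrightarrow{\,i\,}\Sigma_n\to GL_n(\mathbb{R})$, the second map being the permutation representation (there are local trivializations covering the base whose transition functions are the images of a locally constant $\mathbb{Z}/n$-valued cocycle). 3. The first Stiefel–Whitney class $w_1(\xi_{\Gamma,n})\in H^1(\mathrm{Conf}(\Gamma,n)/\Sigma_n;\mathbb{Z}/2)$ is nonzero if and only if $n$ is even. -/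

import Mathlib

open Bundle Topology Set

universe u v w v' w'

noncomputable section

/-! ### Real vector bundles, isomorphism, Whitney sums, order and stable order -/

/-- A real vector bundle of finite rank over `B`. -/
structure RealVB (B : Type u) [TopologicalSpace B] where
  /-- the model fibre -/
  F : Type w
  /-- the fibres -/
  E : B → Type v
  [normedF : NormedAddCommGroup F]
  [spaceF : NormedSpace ℝ F]
  [finiteF : FiniteDimensional ℝ F]
  [addE : ∀ b, AddCommGroup (E b)]
  [modE : ∀ b, Module ℝ (E b)]
  [topTotal : TopologicalSpace (TotalSpace F E)]
  [topE : ∀ b, TopologicalSpace (E b)]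
  [fiber : FiberBundle F E]
  [vector : VectorBundle ℝ F E]

namespace RealVB

attribute [instance] normedF spaceF finiteF addE modE topTotal topE fiber vector

variable {B : Type u} [TopologicalSpace B]

/-- The trivial bundle `B × ℝᵐ`. -/
def trivial (B : Type u) [TopologicalSpace B] (m : ℕ) : RealVB.{u, 0, 0} B where
  F := Fin m → ℝ
  E := Bundle.Trivial B (Fin m → ℝ)

/-- The Whitney sum of two vector bundles. -/
def whitneySum (ξ : RealVB.{u, v, w} B) (η : RealVB.{u, v', w'} B) :
    RealVB.{u, max v v', max w w'} B where
  F := ξ.F × η.F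
  E := ξ.E ×ᵇ η.E

/-- `whitneyPowSucc ξ k` is the `(k + 1)`-fold Whitney sum `ξ ⊕ ⋯ ⊕ ξ`. -/
def whitneyPowSucc (ξ : RealVB.{u, v, w} B) : ℕ → RealVB.{u, v, w} B
  | 0 => ξ
  | k + 1 => whitneySum (whitneyPowSucc ξ k) ξ

/-- Isomorphism of vector bundles over `B`: fibrewise linear isomorphisms that form a
homeomorphism of the total spaces. -/
def IsIso (ξ : RealVB.{u, v, w} B) (η : RealVB.{u, v', w'} B) : Prop :=
  ∃ φ : ∀ b, ξ.E b ≃ₗ[ℝ] η.E b,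
    Continuous (fun z : TotalSpace ξ.F ξ.E => (⟨z.1, φ z.1 z.2⟩ : TotalSpace η.F η.E)) ∧
    Continuous (fun z : TotalSpace η.F η.E => (⟨z.1, (φ z.1).symm z.2⟩ : TotalSpace ξ.F ξ.E))

/-- `ξ` is isomorphic to some `B × ℝᵐ`. -/
def IsTrivial (ξ : RealVB.{u, v, w} B) : Prop := ∃ m : ℕ, IsIso ξ (trivial B m)

/-- `ξ` becomes trivial after adding a trivial bundle. -/
def IsStablyTrivial (ξ : RealVB.{u, v, w} B) : Prop :=
  ∃ j : ℕ, IsTrivial (whitneySum ξ (trivial B j))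

/-- The order of `ξ`: the smallest `m ≥ 1` such that the `m`-fold Whitney sum of `ξ` is trivial
(and `⊤` if there is none). -/
def order (ξ : RealVB.{u, v, w} B) : ℕ∞ :=
  sInf {m : ℕ∞ | ∃ k : ℕ, m = (k + 1 : ℕ) ∧ IsTrivial (whitneyPowSucc ξ k)}

/-- The stable order of `ξ`: the smallest `m ≥ 1` such that the `m`-fold Whitney sum of `ξ` is
stably trivial (and `⊤` if there is none). -/
def stableOrder (ξ : RealVB.{u, v, w} B) : ℕ∞ :=
  sInf {m : ℕ∞ | ∃ k : ℕ, m = (k + 1 : ℕ) ∧ IsStablyTrivial (whitneyPowSucc ξ k)}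

end RealVB

/-- `f` is locally constant at every point of `s`, for open `s`. -/
def LocConstOn {B : Type*} [TopologicalSpace B] {A : Type*} (f : B → A) (s : Set B) : Prop :=
  ∀ b ∈ s, ∀ᶠ b' in 𝓝 b, f b' = f b

/-- The structure group of `ξ` reduces to the discrete group `G`, acting on the model fibre
through `ρ`: there are local trivializations covering `B` whose transition functions are
`ρ ∘ g i j` for a locally constant `G`-valued cocycle `g`. -/
def RealVB.StructureGroupReducesTo {B : Type u} [TopologicalSpace B] (ξ : RealVB.{u, v, w} B)
    {G : Type*} [Group G] (ρ : Representation ℝ G ξ.F) : Prop :=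
  ∃ (ι : Type u) (e : ι → Trivialization ξ.F (π ξ.F ξ.E)) (_ : ∀ i, (e i).IsLinear ℝ)
    (g : ι → ι → B → G),
    (∀ b, ∃ i, b ∈ (e i).baseSet) ∧
    (∀ i j, LocConstOn (g i j) ((e i).baseSet ∩ (e j).baseSet)) ∧
    (∀ i j k, ∀ b ∈ (e i).baseSet ∩ (e j).baseSet ∩ (e k).baseSet,
      g i k b = g i j b * g j k b) ∧
    ∀ i j, ∀ b ∈ (e i).baseSet ∩ (e j).baseSet, ∀ x : ξ.E b,
      (e i ⟨b, x⟩).2 = ρ (g i j b) (e j ⟨b, x⟩).2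

/-! ### First Čech cohomology with constant coefficients

Every open cover is refined by one of the form `(U x)`, `x : B`, with `x ∈ U x`, so the direct
limit over all open covers may be taken over these; the refinement relation is then `U x ⊆ V x`
for all `x`. A class is given by a family `g x y : B → A` that is a Čech 1-cocycle for some such
cover `U` (only the values of `g x y` on `U x ∩ U y` matter, and `U` may be shrunk). -/

namespace Cech

variable (B : Type u) [TopologicalSpace B] (A : Type v) [AddCommGroup A]

/-- Open covers of `B` indexed by the points of `B`. -/
def IsPointCover {B : Type u} [TopologicalSpace B] (U : B → Set B) : Prop :=
  ∀ x, IsOpen (U x) ∧ x ∈ U x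

lemma IsPointCover.inter {B : Type u} [TopologicalSpace B] {U V : B → Set B}
    (hU : IsPointCover U) (hV : IsPointCover V) : IsPointCover (fun x => U x ∩ V x) :=
  fun x => ⟨(hU x).1.inter (hV x).1, (hU x).2, (hV x).2⟩

/-- Čech 1-cocycles, with values in the locally constant functions to `A`, on some cover. -/
def cocycles : AddSubgroup (B → B → B → A) where
  carrier := {g | ∃ U : B → Set B, IsPointCover U ∧
    (∀ x y, LocConstOn (g x y) (U x ∩ U y)) ∧
    ∀ x y z, ∀ b ∈ U x ∩ U y ∩ U z, g x z b = g x y b + g y z b}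
  zero_mem' := ⟨fun _ => univ, fun _ => ⟨isOpen_univ, mem_univ _⟩,
    fun _ _ _ _ => Filter.Eventually.of_forall fun _ => rfl, fun _ _ _ _ _ => by simp⟩
  add_mem' := by
    rintro g g' ⟨U, hU, h1, h2⟩ ⟨U', hU', h1', h2'⟩
    refine ⟨_, hU.inter hU', fun x y b hb => ?_, fun x y z b hb => ?_⟩
    · filter_upwards [h1 x y b ⟨hb.1.1, hb.2.1⟩, h1' x y b ⟨hb.1.2, hb.2.2⟩] with b' e e'
      simp [e, e']
    · have e := h2 x y z b ⟨⟨hb.1.1.1, hb.1.2.1⟩, hb.2.1⟩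
      have e' := h2' x y z b ⟨⟨hb.1.1.2, hb.1.2.2⟩, hb.2.2⟩
      simp only [Pi.add_apply, e, e']
      abel
  neg_mem' := by
    rintro g ⟨U, hU, h1, h2⟩
    refine ⟨U, hU, fun x y b hb => ?_, fun x y z b hb => ?_⟩
    · filter_upwards [h1 x y b hb] with b' e
      simp [e]
    · simp only [Pi.neg_apply, h2 x y z b hb]
      abel

/-- Families that are the Čech coboundary of a 0-cochain on some cover. -/
def coboundaries : AddSubgroup (B → B → B → A) where
  carrier := {g | ∃ U : B → Set B, IsPointCover U ∧ ∃ h : B → B → A,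
    (∀ x, LocConstOn (h x) (U x)) ∧ ∀ x y, ∀ b ∈ U x ∩ U y, g x y b = h y b - h x b}
  zero_mem' := ⟨fun _ => univ, fun _ => ⟨isOpen_univ, mem_univ _⟩, 0,
    fun _ _ _ => Filter.Eventually.of_forall fun _ => rfl, fun _ _ _ _ => by simp⟩
  add_mem' := by
    rintro g g' ⟨U, hU, h, h1, h2⟩ ⟨U', hU', h', h1', h2'⟩
    refine ⟨_, hU.inter hU', h + h', fun x b hb => ?_, fun x y b hb => ?_⟩
    · filter_upwards [h1 x b hb.1, h1' x b hb.2] with b' e e'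
      simp [e, e']
    · simp only [Pi.add_apply, h2 x y b ⟨hb.1.1, hb.2.1⟩, h2' x y b ⟨hb.1.2, hb.2.2⟩]
      abel
  neg_mem' := by
    rintro g ⟨U, hU, h, h1, h2⟩
    refine ⟨U, hU, -h, fun x b hb => ?_, fun x y b hb => ?_⟩
    · filter_upwards [h1 x b hb] with b' e
      simp [e]
    · simp only [Pi.neg_apply, h2 x y b hb]
      abel

/-- The first Čech cohomology group of `B` with coefficients in the discrete group `A`. -/
abbrev H1 : Type (max u v) := cocycles B A ⧸ (coboundaries B A).addSubgroupOf (cocycles B A)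

end Cech

/-! ### The first Stiefel–Whitney class -/

/-- The isomorphism of the component group of `ℝˣ` with `ℤ/2`: positive numbers go to `0`,
negative numbers to `1`. -/
def signBit (r : ℝ) : ZMod 2 := if 0 < r then 0 else 1

lemma signBit_mul {r s : ℝ} (hr : r ≠ 0) (hs : s ≠ 0) :
    signBit (r * s) = signBit r + signBit s := by
  unfold signBit
  rcases lt_or_gt_of_ne hr with h | h <;> rcases lt_or_gt_of_ne hs with h' | h'
  · have := mul_pos_of_neg_of_neg h h'
    simp only [this, h.not_gt, h'.not_gt, if_true, if_false]
    decide
  · have := mul_neg_of_neg_of_pos h h'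
    simp [this.not_gt, h.not_gt, h']
  · have := mul_neg_of_pos_of_neg h h'
    simp [this.not_gt, h'.not_gt, h]
  · have := mul_pos h h'
    simp [this, h, h']

lemma signBit_locConst {r : ℝ} (hr : r ≠ 0) : ∀ᶠ s in 𝓝 r, signBit s = signBit r := by
  unfold signBit
  rcases lt_or_gt_of_ne hr with h | h
  · filter_upwards [eventually_lt_nhds h] with s hs
    simp [hs.not_gt, h.not_gt]
  · filter_upwards [eventually_gt_nhds h] with s hs
    simp [hs, h]

namespace RealVB

variable {B : Type u} [TopologicalSpace B]

/-- The transition function of `ξ` at `b` from the trivialization around `x` to the one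
around `y`. -/
def transition (ξ : RealVB.{u, v, w} B) (x y b : B) : ξ.F ≃L[ℝ] ξ.F :=
  (trivializationAt ξ.F ξ.E x).coordChangeL ℝ (trivializationAt ξ.F ξ.E y) b

lemma transition_det_ne_zero (ξ : RealVB.{u, v, w} B) (x y b : B) :
    (ξ.transition x y b : ξ.F →L[ℝ] ξ.F).det ≠ 0 :=
  (LinearEquiv.isUnit_det' (ξ.transition x y b).toLinearEquiv).ne_zero

/-- The signs of the determinants of the transition functions. -/
def detCocycle (ξ : RealVB.{u, v, w} B) (x y b : B) : ZMod 2 :=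
  signBit (ξ.transition x y b : ξ.F →L[ℝ] ξ.F).det

lemma detCocycle_mem (ξ : RealVB.{u, v, w} B) : ξ.detCocycle ∈ Cech.cocycles B (ZMod 2) := by
  refine ⟨fun x => (trivializationAt ξ.F ξ.E x).baseSet,
    fun x => ⟨(trivializationAt ξ.F ξ.E x).open_baseSet,
      FiberBundle.mem_baseSet_trivializationAt ξ.F ξ.E x⟩, fun x y b hb => ?_,
    fun x y z b hb => ?_⟩
  · have hc := (continuousOn_coordChange ℝ (trivializationAt ξ.F ξ.E x)
      (trivializationAt ξ.F ξ.E y)).continuousAt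
      (((trivializationAt ξ.F ξ.E x).open_baseSet.inter
        (trivializationAt ξ.F ξ.E y).open_baseSet).mem_nhds hb)
    have hd := (ContinuousLinearMap.continuous_det (E := ξ.F) (𝕜 := ℝ)).continuousAt.comp hc
    exact hd.eventually (signBit_locConst (ξ.transition_det_ne_zero x y b))
  · unfold detCocycle
    rw [add_comm, ← signBit_mul (ξ.transition_det_ne_zero _ _ _) (ξ.transition_det_ne_zero _ _ _)]
    congr 1
    have : (ξ.transition x z b : ξ.F →L[ℝ] ξ.F) =
        (ξ.transition y z b : ξ.F →L[ℝ] ξ.F).comp (ξ.transition x y b : ξ.F →L[ℝ] ξ.F) := by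
      ext v
      simp only [transition, ContinuousLinearMap.comp_apply, ContinuousLinearEquiv.coe_coe]
      rw [Trivialization.coordChangeL_apply _ _ ⟨hb.1.1, hb.2⟩,
        Trivialization.coordChangeL_apply _ _ ⟨hb.1.2, hb.2⟩,
        Trivialization.coordChangeL_apply _ _ ⟨hb.1.1, hb.1.2⟩,
        Trivialization.symm_apply_apply_mk _ hb.1.2]
    rw [this]
    exact LinearMap.det_comp _ _

/-- The first Stiefel–Whitney class of `ξ` in the first Čech cohomology of the base. -/
def stiefelWhitneyOne (ξ : RealVB.{u, v, w} B) : Cech.H1 B (ZMod 2) :=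
  QuotientAddGroup.mk ⟨ξ.detCocycle, ξ.detCocycle_mem⟩

end RealVB

/-! ### Configuration spaces and the canonical vector bundle -/

/-- The ordered configuration space `Conf(X, n)`. -/
abbrev Conf (X : Type u) (n : ℕ) : Type u := {x : Fin n → X // Function.Injective x}

namespace Conf

variable {X : Type u} {n : ℕ}

/-- The action of a permutation: `(x₁, …, xₙ) ↦ (x_{σ(1)}, …, x_{σ(n)})`. -/
def perm (x : Conf X n) (σ : Equiv.Perm (Fin n)) : Conf X n :=
  ⟨x.1 ∘ σ, x.2.comp σ.injective⟩

lemma perm_inj {x : Conf X n} {σ τ : Equiv.Perm (Fin n)} (h : x.perm σ = x.perm τ) : σ = τ := by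
  ext i
  have := congrFun (congrArg Subtype.val h) i
  exact congrArg Fin.val (x.2 this)

variable (X n) in
/-- Being in the same orbit of `Σₙ` on `Conf(X, n)`. -/
abbrev orbit : Setoid (Conf X n) where
  r x y := ∃ σ : Equiv.Perm (Fin n), y = x.perm σ
  iseqv :=
    { refl := fun x => ⟨1, rfl⟩
      symm := by
        rintro x y ⟨σ, rfl⟩
        exact ⟨σ⁻¹, Subtype.ext (funext fun i => by simp [perm])⟩
      trans := by
        rintro x y z ⟨σ, rfl⟩ ⟨τ, rfl⟩
        exact ⟨σ * τ, rfl⟩ }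

variable (X n) in
/-- Being in the same orbit of `Σₙ` acting simultaneously on `Conf(X, n)` and `ℝⁿ`. -/
abbrev assocOrbit : Setoid (Conf X n × (Fin n → ℝ)) where
  r p q := ∃ σ : Equiv.Perm (Fin n), q = (p.1.perm σ, p.2 ∘ σ)
  iseqv :=
    { refl := fun x => ⟨1, rfl⟩
      symm := by
        rintro p q ⟨σ, rfl⟩
        refine ⟨σ⁻¹, Prod.ext (Subtype.ext (funext fun i => ?_)) (funext fun i => ?_)⟩ <;>
          simp [perm]
      trans := by
        rintro p q r ⟨σ, rfl⟩ ⟨τ, rfl⟩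
        exact ⟨σ * τ, rfl⟩ }

variable (X n) in
/-- The unordered configuration space `Conf(X, n)/Σₙ`. -/
abbrev Unordered : Type u := Quotient (orbit X n)

variable (X n) in
/-- The total space `Conf(X, n) ×_{Σₙ} ℝⁿ`. -/
abbrev Assoc : Type u := Quotient (assocOrbit X n)

/-- The covering projection `Conf(X, n) → Conf(X, n)/Σₙ`. -/
def toUnordered (x : Conf X n) : Unordered X n := Quotient.mk _ x

/-- The quotient map onto `Conf(X, n) ×_{Σₙ} ℝⁿ`. -/
def toAssoc (p : Conf X n × (Fin n → ℝ)) : Assoc X n := Quotient.mk _ p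

lemma toUnordered_eq {x y : Conf X n} : x.toUnordered = y.toUnordered ↔ ∃ σ, y = x.perm σ :=
  Quotient.eq

lemma toAssoc_eq {p q : Conf X n × (Fin n → ℝ)} :
    toAssoc p = toAssoc q ↔ ∃ σ : Equiv.Perm (Fin n), q = (p.1.perm σ, p.2 ∘ σ) :=
  Quotient.eq

/-- The bundle projection `Conf(X, n) ×_{Σₙ} ℝⁿ → Conf(X, n)/Σₙ`. -/
def proj : Assoc X n → Unordered X n :=
  Quotient.map Prod.fst (by rintro p q ⟨σ, rfl⟩; exact ⟨σ, rfl⟩)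

/-- The fibre over `q` of `Conf(X, n) ×_{Σₙ} ℝⁿ → Conf(X, n)/Σₙ`. -/
def Fibre (q : Unordered X n) : Type u := {z : Assoc X n // proj z = q}

/-- An ordering `x` of `q` identifies `ℝⁿ` with the fibre over `q`, by `v ↦ [x, v]`. -/
def fibreEquiv (x : Conf X n) {q : Unordered X n} (hx : x.toUnordered = q) :
    (Fin n → ℝ) ≃ Fibre q :=
  Equiv.ofBijective (fun v => ⟨toAssoc (x, v), hx⟩) <| by
    constructor
    · intro v w h
      obtain ⟨σ, hσ⟩ := toAssoc_eq.1 (congrArg Subtype.val h)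
      obtain rfl : (1 : Equiv.Perm (Fin n)) = σ := perm_inj (congrArg Prod.fst hσ)
      exact (congrArg Prod.snd hσ).symm
    · rintro ⟨z, hz⟩
      obtain ⟨⟨y, w⟩, rfl⟩ := Quotient.exists_rep z
      obtain ⟨σ, hσ⟩ := toUnordered_eq.1 (show y.toUnordered = x.toUnordered from hz.trans hx.symm)
      exact ⟨w ∘ σ, Subtype.ext (toAssoc_eq.2 ⟨σ, by rw [hσ]⟩).symm⟩

lemma fibreEquiv_perm (x : Conf X n) {q : Unordered X n} (hx : x.toUnordered = q)
    (σ : Equiv.Perm (Fin n)) (hx' : (x.perm σ).toUnordered = q) (v : Fin n → ℝ) :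
    fibreEquiv (x.perm σ) hx' (v ∘ σ) = fibreEquiv x hx v :=
  Subtype.ext (show toAssoc (x, v) = toAssoc (x.perm σ, v ∘ σ) from toAssoc_eq.2 ⟨σ, rfl⟩).symm

/-- The vector space structure of the fibres: `[x, v] + [x, w] = [x, v + w]` and
`r • [x, v] = [x, r • v]`, for one (equivalently, by `fibreLinearEquiv`, every) ordering `x`. -/
instance (q : Unordered X n) : AddCommGroup (Fibre q) :=
  (fibreEquiv q.out q.out_eq).symm.addCommGroup

instance (q : Unordered X n) : Module ℝ (Fibre q) :=
  (fibreEquiv q.out q.out_eq).symm.module ℝ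

/-- `v ↦ [x, v]` is linear for every ordering `x` of `q`. -/
def fibreLinearEquiv (x : Conf X n) {q : Unordered X n} (hx : x.toUnordered = q) :
    (Fin n → ℝ) ≃ₗ[ℝ] Fibre q where
  toEquiv := fibreEquiv x hx
  map_add' v w := by
    obtain ⟨σ, hσ⟩ := toUnordered_eq.1
      (show x.toUnordered = toUnordered q.out from hx.trans q.out_eq.symm)
    have key : ∀ v, fibreEquiv x hx v = fibreEquiv q.out q.out_eq (v ∘ σ) := fun v => by
      have := fibreEquiv_perm x hx σ (hσ ▸ q.out_eq) v
      rw [← this]; congr 1; simp only [hσ]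
    change fibreEquiv x hx (v + w) = fibreEquiv x hx v + fibreEquiv x hx w
    rw [key, key, key, Equiv.add_def]
    simp only [Equiv.symm_symm, Equiv.symm_apply_apply]
    rfl
  map_smul' r v := by
    obtain ⟨σ, hσ⟩ := toUnordered_eq.1
      (show x.toUnordered = toUnordered q.out from hx.trans q.out_eq.symm)
    have key : ∀ v, fibreEquiv x hx v = fibreEquiv q.out q.out_eq (v ∘ σ) := fun v => by
      have := fibreEquiv_perm x hx σ (hσ ▸ q.out_eq) v
      rw [← this]; congr 1; simp only [hσ]
    change fibreEquiv x hx (r • v) = r • fibreEquiv x hx v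
    rw [key, key, Equiv.smul_def]
    simp only [Equiv.symm_symm, Equiv.symm_apply_apply]
    rfl

/-- The points of the bundle as elements of `Conf(X, n) ×_{Σₙ} ℝⁿ`. -/
def total : TotalSpace (Fin n → ℝ) (Fibre (X := X) (n := n)) ≃ Assoc X n where
  toFun z := z.2.1
  invFun z := ⟨proj z, z, rfl⟩
  left_inv := by rintro ⟨_, z, rfl⟩; rfl
  right_inv _ := rfl

open Classical in
/-- The ordering of `q` lying in `W`, if there is one. -/
def sec (W : Set (Conf X n)) (q : Unordered X n) : Conf X n :=
  if h : ∃ x ∈ W, x.toUnordered = q then h.choose else q.out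

lemma toUnordered_sec (W : Set (Conf X n)) (q : Unordered X n) : (sec W q).toUnordered = q := by
  unfold sec
  split_ifs with h
  · exact h.choose_spec.2
  · exact q.out_eq

lemma sec_toUnordered {W : Set (Conf X n)} (hW : InjOn toUnordered W) {x : Conf X n}
    (hx : x ∈ W) : sec W x.toUnordered = x := by
  have h : ∃ y ∈ W, y.toUnordered = x.toUnordered := ⟨x, hx, rfl⟩
  unfold sec
  rw [dif_pos h]
  exact hW h.choose_spec.1 hx h.choose_spec.2

/-- The point `[x, v]` of the bundle. -/
def point (x : Conf X n) (v : Fin n → ℝ) : TotalSpace (Fin n → ℝ) (Fibre (X := X) (n := n)) :=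
  ⟨x.toUnordered, fibreLinearEquiv x rfl v⟩

lemma point_surj (z : TotalSpace (Fin n → ℝ) (Fibre (X := X) (n := n))) (x : Conf X n)
    (hx : x.toUnordered = z.1) : point x ((fibreLinearEquiv x hx).symm z.2) = z := by
  obtain ⟨q, z⟩ := z
  change x.toUnordered = q at hx
  subst hx
  simp [point]

variable [TopologicalSpace X]

/-- The topology of the total space is the quotient topology of `Conf(X, n) ×_{Σₙ} ℝⁿ`. -/
instance : TopologicalSpace (TotalSpace (Fin n → ℝ) (Fibre (X := X) (n := n))) :=
  TopologicalSpace.induced total inferInstance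

instance (q : Unordered X n) : TopologicalSpace (Fibre q) := instTopologicalSpaceSubtype


lemma isInducing_total : IsInducing (total (X := X) (n := n)) := ⟨rfl⟩

lemma continuous_toUnordered : Continuous (toUnordered (X := X) (n := n)) := continuous_quotient_mk'

lemma continuous_perm (σ : Equiv.Perm (Fin n)) : Continuous (fun x : Conf X n => x.perm σ) :=
  (continuous_pi fun i => (continuous_apply (σ i)).comp continuous_subtype_val :
    Continuous fun x : Conf X n => x.1 ∘ σ).subtype_mk _

lemma isOpenMap_toUnordered : IsOpenMap (toUnordered (X := X) (n := n)) := by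
  intro W hW
  have : toUnordered ⁻¹' (toUnordered '' W) =
      ⋃ σ : Equiv.Perm (Fin n), (fun x : Conf X n => x.perm σ) ⁻¹' W := by
    ext x
    simp only [mem_preimage, mem_image, mem_iUnion]
    constructor
    · rintro ⟨y, hy, h⟩
      obtain ⟨σ, rfl⟩ := toUnordered_eq.1 h.symm
      exact ⟨σ, hy⟩
    · rintro ⟨σ, h⟩
      exact ⟨_, h, (toUnordered_eq.2 ⟨σ, rfl⟩).symm⟩
  change IsOpen (toUnordered ⁻¹' (toUnordered '' W))
  rw [this]
  exact isOpen_iUnion fun σ => hW.preimage (continuous_perm σ)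

lemma isOpenMap_toAssoc : IsOpenMap (toAssoc (X := X) (n := n)) := by
  intro W hW
  have : toAssoc ⁻¹' (toAssoc '' W) = ⋃ σ : Equiv.Perm (Fin n),
      (fun p : Conf X n × (Fin n → ℝ) => (p.1.perm σ, p.2 ∘ σ)) ⁻¹' W := by
    ext x
    simp only [mem_preimage, mem_image, mem_iUnion]
    constructor
    · rintro ⟨y, hy, h⟩
      obtain ⟨σ, rfl⟩ := toAssoc_eq.1 h.symm
      exact ⟨σ, hy⟩
    · rintro ⟨σ, h⟩
      exact ⟨_, h, (toAssoc_eq.2 ⟨σ, rfl⟩).symm⟩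
  change IsOpen (toAssoc ⁻¹' (toAssoc '' W))
  rw [this]
  refine isOpen_iUnion fun σ => hW.preimage (((continuous_perm σ).comp continuous_fst).prodMk ?_)
  exact continuous_pi fun i => (continuous_apply (σ i)).comp continuous_snd

/-- An open set of ordered configurations containing at most one ordering of each
configuration. -/
def IsSheet (W : Set (Conf X n)) : Prop :=
  IsOpen W ∧ InjOn toUnordered W

lemma exists_sheet [T2Space X] (x : Conf X n) : ∃ W : Set (Conf X n), IsSheet W ∧ x ∈ W := by
  obtain ⟨U, hU, hd⟩ := (Set.finite_range x.1).t2_separation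
  refine ⟨{y | ∀ i, y.1 i ∈ U (x.1 i)}, ⟨?_, ?_⟩, fun i => (hU _).1⟩
  · simp only [ofPred_forall]
    exact isOpen_iInter_of_finite fun i =>
      (hU _).2.preimage ((continuous_apply i).comp continuous_subtype_val)
  · intro y hy z hz h
    obtain ⟨σ, rfl⟩ := toUnordered_eq.1 h
    have : ∀ i, σ i = i := fun i => by
      by_contra hne
      exact Set.disjoint_left.1 (hd (mem_range_self (σ i)) (mem_range_self i)
        (fun h => hne (x.2 h))) (hy (σ i)) (hz i)
    exact Subtype.ext (funext fun i => by simp [perm, this])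

lemma isOpenEmbedding_point {W : Set (Conf X n)} (hW : IsSheet W) :
    IsOpenEmbedding (fun p : W × (Fin n → ℝ) => point p.1.1 p.2) := by
  have hop : IsOpenEmbedding
      (fun p : W × (Fin n → ℝ) => ((p.1.1, p.2) : Conf X n × (Fin n → ℝ))) :=
    hW.1.isOpenEmbedding_subtypeVal.prodMap IsOpenEmbedding.id
  refine .of_continuous_injective_isOpenMap ?_ ?_ ?_
  · rw [isInducing_total.continuous_iff]
    exact continuous_quotient_mk'.comp hop.continuous
  · rintro ⟨⟨x, hx⟩, v⟩ ⟨⟨y, hy⟩, w⟩ h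
    obtain rfl : x = y := hW.2 hx hy (congrArg TotalSpace.proj h)
    have := (fibreEquiv x rfl).injective
      (a₁ := v) (a₂ := w) (Subtype.ext (congrArg total h))
    rw [this]
  · intro S hS
    have h := isOpenMap_toAssoc _ (hop.isOpenMap S hS)
    refine isInducing_total.isOpen_iff.2 ⟨_, h, ?_⟩
    rw [← image_comp]
    have : (fun p : W × (Fin n → ℝ) => point p.1.1 p.2) '' S =
      total.symm '' ((toAssoc ∘ fun p : W × (Fin n → ℝ) => (p.1.1, p.2)) '' S) := by
      rw [← image_comp]; rfl
    rw [this, Equiv.image_symm_eq_preimage]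

lemma isOpenEmbedding_base {W : Set (Conf X n)} (hW : IsSheet W) :
    IsOpenEmbedding (fun p : W × (Fin n → ℝ) => (p.1.1.toUnordered, p.2)) := by
  refine IsOpenEmbedding.prodMap (f := fun x : W => x.1.toUnordered) ?_ IsOpenEmbedding.id
  exact .of_continuous_injective_isOpenMap (continuous_toUnordered.comp continuous_subtype_val)
    (fun x y h => Subtype.ext (hW.2 x.2 y.2 h))
    (isOpenMap_toUnordered.comp hW.1.isOpenMap_subtype_val)

/-- The local trivialization `[x, v] ↦ ([x], v)`, for `x ∈ W`. -/
def sheetTriv (W : Set (Conf X n)) (hW : IsSheet W) :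
    Trivialization (Fin n → ℝ) (π (Fin n → ℝ) (Fibre (X := X) (n := n))) where
  toFun z := (z.1, (fibreLinearEquiv (sec W z.1) (toUnordered_sec W z.1)).symm z.2)
  invFun p := ⟨p.1, fibreLinearEquiv (sec W p.1) (toUnordered_sec W p.1) p.2⟩
  source := π (Fin n → ℝ) (Fibre (X := X) (n := n)) ⁻¹' (toUnordered '' W)
  target := (toUnordered '' W) ×ˢ univ
  map_source' z hz := ⟨hz, mem_univ _⟩
  map_target' p hp := hp.1
  left_inv' z _ := by simp
  right_inv' p _ := by simp
  open_source := by
    have h := (isOpenEmbedding_point hW).isOpen_range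
    convert h using 1
    ext z
    constructor
    · rintro ⟨x, hx, h⟩
      exact ⟨(⟨x, hx⟩, _), point_surj z x h⟩
    · rintro ⟨⟨x, v⟩, rfl⟩
      exact ⟨x.1, x.2, rfl⟩
  open_target := (isOpenMap_toUnordered W hW.1).prod isOpen_univ
  continuousOn_toFun := by
    rintro z ⟨x, hx, h⟩
    refine ContinuousAt.continuousWithinAt ?_
    rw [← point_surj z x h]
    refine ((isOpenEmbedding_point hW).continuousAt_iff
      (x := ((⟨x, hx⟩ : W), (fibreLinearEquiv x h).symm z.2))).1 ?_
    convert (isOpenEmbedding_base hW).continuous.continuousAt using 1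
    funext p
    have e := sec_toUnordered hW.2 p.1.2
    refine Prod.ext rfl ?_
    change (fibreLinearEquiv (sec W p.1.1.toUnordered) _).symm (fibreLinearEquiv p.1.1 rfl p.2) = p.2
    simp only [e, LinearEquiv.symm_apply_apply]
  continuousOn_invFun := by
    rintro ⟨q, v⟩ ⟨⟨x, hx, rfl⟩, _⟩
    refine ContinuousAt.continuousWithinAt ?_
    refine ((isOpenEmbedding_base hW).continuousAt_iff (x := ((⟨x, hx⟩ : W), v))).1 ?_
    convert (isOpenEmbedding_point hW).continuous.continuousAt using 1
    funext p
    have e := sec_toUnordered hW.2 p.1.2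
    simp only [Function.comp_apply, point, e]
  baseSet := toUnordered '' W
  open_baseSet := isOpenMap_toUnordered W hW.1
  source_eq := rfl
  target_eq := rfl
  proj_toFun _ _ := rfl

instance (W : Set (Conf X n)) (hW : IsSheet W) : (sheetTriv W hW).IsLinear ℝ where
  linear q _ := (fibreLinearEquiv (sec W q) (toUnordered_sec W q)).symm.isLinear

/-- A sheet containing `x`. -/
def sheet [T2Space X] (x : Conf X n) : Set (Conf X n) := (exists_sheet x).choose

lemma isSheet_sheet [T2Space X] (x : Conf X n) : IsSheet (sheet x) :=
  (exists_sheet x).choose_spec.1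

lemma mem_sheet [T2Space X] (x : Conf X n) : x ∈ sheet x := (exists_sheet x).choose_spec.2

instance [T2Space X] : FiberBundle (Fin n → ℝ) (Fibre (X := X) (n := n)) where
  totalSpaceMk_isInducing' q := by
    rw [← isInducing_total.of_comp_iff]
    exact IsInducing.subtypeVal
  trivializationAtlas' := {e | ∃ W hW, e = sheetTriv W hW}
  trivializationAt' q := sheetTriv (sheet q.out) (isSheet_sheet _)
  mem_baseSet_trivializationAt' q := ⟨q.out, mem_sheet _, q.out_eq⟩
  trivialization_mem_atlas' _ := ⟨_, _, rfl⟩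

instance [T2Space X] : VectorBundle ℝ (Fin n → ℝ) (Fibre (X := X) (n := n)) where
  trivialization_linear' := by
    rintro _ ⟨W, hW, rfl⟩
    infer_instance
  continuousOn_coordChange' := by
    rintro _ _ ⟨W, hW, rfl⟩ ⟨W', hW', rfl⟩
    rw [continuousOn_clm_apply]
    intro v
    have h : ContinuousOn (fun b => (sheetTriv W' hW'
        ((sheetTriv W hW).toOpenPartialHomeomorph.symm (b, v))).2)
        ((sheetTriv W hW).baseSet ∩ (sheetTriv W' hW').baseSet) := by
      refine continuous_snd.comp_continuousOn
        ((sheetTriv W' hW').continuousOn_toFun.comp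
          ((sheetTriv W hW).continuousOn_invFun.comp
            (Continuous.prodMk_left v).continuousOn ?_) ?_)
      · intro b hb; exact ⟨hb.1, mem_univ _⟩
      · intro b hb; exact hb.2
    refine h.congr fun b hb => ?_
    exact Trivialization.coordChangeL_apply' _ _ hb v

/-- The canonical vector bundle `ξ_{X,n} : Conf(X, n) ×_{Σₙ} ℝⁿ → Conf(X, n)/Σₙ`. -/
def canonicalBundle (X : Type u) [TopologicalSpace X] [T2Space X] (n : ℕ) :
    RealVB.{u, u, 0} (Unordered X n) where
  F := Fin n → ℝ
  E := Fibre

/-- The permutation representation of `Σₙ` on `ℝⁿ`, sending the basis vector `eᵢ` to `e_{σ(i)}`. -/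
def permRep (n : ℕ) : Representation ℝ (Equiv.Perm (Fin n)) (Fin n → ℝ) where
  toFun σ := LinearMap.funLeft ℝ ℝ (σ⁻¹ : Equiv.Perm (Fin n))
  map_one' := rfl
  map_mul' σ τ := by ext; simp [LinearMap.funLeft]

/-- The structure group of the covering `Conf(X, n) → Conf(X, n)/Σₙ` reduces along
`i : G → Σₙ` to the discrete group `G`: there are local sections over an open cover that
differ by `i ∘ g j k` for a locally constant `G`-valued cocycle `g`. -/
def CoveringReducesTo (X : Type u) [TopologicalSpace X] (n : ℕ) {G : Type*} [Group G]
    (i : G →* Equiv.Perm (Fin n)) : Prop :=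
  ∃ (ι : Type u) (U : ι → Set (Unordered X n)) (s : ι → Unordered X n → Conf X n)
    (g : ι → ι → Unordered X n → G),
    (∀ j, IsOpen (U j)) ∧ (∀ b, ∃ j, b ∈ U j) ∧
    (∀ j, ContinuousOn (s j) (U j) ∧ ∀ b ∈ U j, (s j b).toUnordered = b) ∧
    (∀ j k, LocConstOn (g j k) (U j ∩ U k)) ∧
    (∀ j k l, ∀ b ∈ U j ∩ U k ∩ U l, g j l b = g j k b * g k l b) ∧
    ∀ j k, ∀ b ∈ U j ∩ U k, s k b = (s j b).perm (i (g j k b))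

end Conf

end

/-! A trivialization of the bundle is a continuous family of isomorphisms from a fixed vector space
to $\mathbb{R}^n$, indexed by ordered configurations and equivariant under $\Sigma_n$. Evaluating
functions at the $n$ points is automatically equivariant, so an $n$-dimensional space of functions
trivializes the bundle as soon as no nonzero member vanishes at $n$ distinct points of the circle.

For odd $n$, take the forms of degree $n-1$ in $\cos(t/2)$ and $\sin(t/2)$. Their degree is even, so
they are well defined on the circle, and a projective Vandermonde determinant shows that evaluation
is invertible (`det_halfAngleMatrix_ne_zero`). For every $n$, complex polynomials of degree less
than $n$ trivialize the complexification by the ordinary Vandermonde determinant. As a real bundle,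
the complexification is the double of the bundle, so the order is at most 2.

The obstruction for even $n$ is orientability. An orientation is a locally constant function on
ordered configurations that changes by the parity of a permutation. It exists when the bundle is
stably trivial (`exists_isOrientation_of_isStablyTrivial`), and it exists exactly when $w_1$
vanishes (`stiefelWhitneyOne_canonicalBundle_eq_zero_iff`). Rotating $n$ equally spaced points by
$1/n$ of a turn joins a configuration to its image under an $n$-cycle, which is odd for even $n$, so
no orientation exists then (`not_isOrientation_of_even`).

For the reduction to $\mathbb{Z}/n$, the counterclockwise orderings form an open set that meets
every orbit in one coset of the rotations. Local sections with values in this set differ by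
rotations, and since $\Sigma_n$ acts freely these rotations form a locally constant cocycle. -/

noncomputable section

/-! ### Frames, triviality and orders of vector bundles -/

namespace RealVB

variable {B : Type u} [TopologicalSpace B]

lemma continuous_trivial_iff {X : Type*} [TopologicalSpace X] {m : ℕ}
    {f : X → TotalSpace (trivial B m).F (trivial B m).E} :
    Continuous f ↔ Continuous (fun x => (f x).1) ∧
      Continuous (fun x => ((f x).2 : Fin m → ℝ)) := by
  exact (Bundle.Trivial.isInducing_toProd B (Fin m → ℝ)).continuous_iff.trans continuous_prodMk

lemma continuous_whitneySum_iff {X : Type*} [TopologicalSpace X] {ξ : RealVB.{u, v, w} B}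
    {η : RealVB.{u, v', w'} B} {f : X → TotalSpace (whitneySum ξ η).F (whitneySum ξ η).E} :
    Continuous f ↔ Continuous (fun x => (⟨(f x).1, (f x).2.1⟩ : TotalSpace ξ.F ξ.E)) ∧
      Continuous (fun x => (⟨(f x).1, (f x).2.2⟩ : TotalSpace η.F η.E)) := by
  exact (FiberBundle.Prod.isInducing_diag ξ.F ξ.E η.F η.E).continuous_iff.trans continuous_prodMk

/-- A continuous family of isomorphisms of a fixed vector space with the fibres trivializes the
bundle. -/
theorem isTrivial_of_frame (ξ : RealVB.{u, v, w} B) {W : Type*} [NormedAddCommGroup W]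
    [NormedSpace ℝ W] [FiniteDimensional ℝ W] (ψ : ∀ b, W ≃ₗ[ℝ] ξ.E b)
    (hψ : ∀ w, Continuous fun b => (⟨b, ψ b w⟩ : TotalSpace ξ.F ξ.E)) : ξ.IsTrivial := by
  let L : W ≃L[ℝ] (Fin (Module.finrank ℝ W) → ℝ) :=
    (Module.finBasis ℝ W).equivFunL
  have key : ∀ b₀ : B, ∃ A : B → (W →L[ℝ] ξ.F),
      ContinuousOn A (trivializationAt ξ.F ξ.E b₀).baseSet ∧
      (∀ b ∈ (trivializationAt ξ.F ξ.E b₀).baseSet, ∀ w,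
        A b w = (trivializationAt ξ.F ξ.E b₀ ⟨b, ψ b w⟩).2) ∧
      ∀ b ∈ (trivializationAt ξ.F ξ.E b₀).baseSet, (A b).IsInvertible := by
    intro b₀
    set e := trivializationAt ξ.F ξ.E b₀
    refine ⟨fun b => LinearMap.toContinuousLinearMap ((e.linearMapAt ℝ b).comp (ψ b).toLinearMap),
      ?_, ?_, ?_⟩
    · rw [continuousOn_clm_apply]
      intro w
      refine (continuous_snd.comp_continuousOn (e.continuousOn_toFun.comp (hψ w).continuousOn
        fun b hb => e.mem_source.2 hb)).congr fun b hb => ?_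
      simp [hb]
    · intro b hb w
      simp [hb]
    · intro b hb
      refine ⟨((ψ b).trans (e.linearEquivAt ℝ b hb)).toContinuousLinearEquiv, ?_⟩
      ext w
      simp [hb]
  refine ⟨_, fun b => (ψ b).symm.trans L.toLinearEquiv, ?_, ?_⟩
  · rw [continuous_trivial_iff]
    refine ⟨FiberBundle.continuous_proj ξ.F ξ.E, L.continuous.comp ?_⟩
    rw [continuous_iff_continuousAt]
    intro z₀
    obtain ⟨A, hA, hA', hA''⟩ := key z₀.1
    set e := trivializationAt ξ.F ξ.E z₀.1
    have hb₀ : z₀.1 ∈ e.baseSet := FiberBundle.mem_baseSet_trivializationAt ξ.F ξ.E z₀.1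
    -- Only this direction needs an inverse: inversion of operators is continuous at an invertible
    -- one.
    have h1 : ContinuousAt (fun z : TotalSpace ξ.F ξ.E => (A z.1).inverse) z₀ := by
      obtain ⟨M, hM⟩ := hA'' _ hb₀
      have h := (contDiffAt_map_inverse (𝕜 := ℝ) (n := 0) M).continuousAt
      rw [hM] at h
      exact ContinuousAt.comp (g := ContinuousLinearMap.inverse)
        (f := fun z : TotalSpace ξ.F ξ.E => A z.1) h
        ((hA.continuousAt (e.open_baseSet.mem_nhds hb₀)).comp
          (FiberBundle.continuous_proj ξ.F ξ.E).continuousAt)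
    have h2 : ContinuousAt (fun z : TotalSpace ξ.F ξ.E => (e z).2) z₀ :=
      continuous_snd.continuousAt.comp
        (e.continuousOn_toFun.continuousAt (e.open_source.mem_nhds (e.mem_source.2 hb₀)))
    refine (h1.clm_apply h2).congr ?_
    filter_upwards [e.open_source.mem_nhds (e.mem_source.2 hb₀)] with z hz
    have hz' := e.mem_source.1 hz
    have h3 : (e z).2 = A z.1 ((ψ z.1).symm z.2) := by
      rw [hA' _ hz']
      simp
    rw [h3, (hA'' _ hz').inverse_apply_self]
    rfl
  · rw [continuous_iff_continuousAt]
    intro z₀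
    obtain ⟨A, hA, hA', -⟩ := key z₀.1
    set e := trivializationAt ξ.F ξ.E z₀.1
    have hb₀ : z₀.1 ∈ e.baseSet := FiberBundle.mem_baseSet_trivializationAt ξ.F ξ.E z₀.1
    obtain ⟨hc1, hc2⟩ := continuous_trivial_iff.1
      (continuous_id : Continuous (id : TotalSpace (trivial B (Module.finrank ℝ W)).F _ → _))
    refine (FiberBundle.continuousAt_totalSpace ξ.F _).2 ⟨hc1.continuousAt, ?_⟩
    have h1 : ContinuousAt (fun z : TotalSpace (trivial B (Module.finrank ℝ W)).F
        (trivial B (Module.finrank ℝ W)).E => A z.1 (L.symm z.2)) z₀ :=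
      ((hA.continuousAt (e.open_baseSet.mem_nhds hb₀)).comp hc1.continuousAt).clm_apply
        (L.symm.continuous.comp hc2).continuousAt
    refine h1.congr ?_
    filter_upwards [hc1.continuousAt (e.open_baseSet.mem_nhds hb₀)] with z hz
    exact hA' z.1 hz (L.symm z.2)

lemma IsTrivial.isStablyTrivial {ξ : RealVB.{u, v, w} B} (h : ξ.IsTrivial) :
    ξ.IsStablyTrivial := by
  obtain ⟨m, φ, h1, h2⟩ := h
  refine ⟨0, m, fun b => LinearEquiv.ofLinearMap (M := ξ.E b × (Fin 0 → ℝ)) (M₂ := Fin m → ℝ)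
    ((φ b).toLinearMap.comp (LinearMap.fst ℝ _ _))
    ((LinearMap.inl ℝ _ _).comp (φ b).symm.toLinearMap) ?_ ?_, ?_, ?_⟩
  · exact LinearMap.ext fun v => (φ b).apply_symm_apply v
  · exact LinearMap.ext fun z => Prod.ext ((φ b).symm_apply_apply z.1) (Subsingleton.elim _ _)
  · exact h1.comp (continuous_whitneySum_iff.1 (continuous_id :
      Continuous (id : TotalSpace (whitneySum ξ (trivial B 0)).F _ → _))).1
  · refine continuous_whitneySum_iff.2 ⟨h2, continuous_trivial_iff.2 ⟨?_, continuous_const⟩⟩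
    exact (continuous_trivial_iff.1 (continuous_id :
      Continuous (id : TotalSpace (trivial B m).F _ → _))).1

lemma order_eq_one {ξ : RealVB.{u, v, w} B} (h : ξ.IsTrivial) : ξ.order = 1 := by
  refine le_antisymm (sInf_le ⟨0, rfl, h⟩) (le_sInf ?_)
  rintro _ ⟨k, rfl, -⟩
  exact_mod_cast Nat.succ_le_succ (Nat.zero_le k)

lemma stableOrder_eq_one {ξ : RealVB.{u, v, w} B} (h : ξ.IsStablyTrivial) :
    ξ.stableOrder = 1 := by
  refine le_antisymm (sInf_le ⟨0, rfl, h⟩) (le_sInf ?_)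
  rintro _ ⟨k, rfl, -⟩
  exact_mod_cast Nat.succ_le_succ (Nat.zero_le k)

lemma order_eq_two {ξ : RealVB.{u, v, w} B} (h : ¬ ξ.IsTrivial)
    (h' : (whitneySum ξ ξ).IsTrivial) : ξ.order = 2 := by
  refine le_antisymm (sInf_le ⟨1, rfl, h'⟩) (le_sInf ?_)
  rintro _ ⟨k, rfl, hk⟩
  obtain _ | k := k
  · exact absurd hk h
  · exact_mod_cast Nat.le_add_left 2 k

lemma stableOrder_eq_two {ξ : RealVB.{u, v, w} B} (h : ¬ ξ.IsStablyTrivial)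
    (h' : (whitneySum ξ ξ).IsStablyTrivial) : ξ.stableOrder = 2 := by
  refine le_antisymm (sInf_le ⟨1, rfl, h'⟩) (le_sInf ?_)
  rintro _ ⟨k, rfl, hk⟩
  obtain _ | k := k
  · exact absurd hk h
  · exact_mod_cast Nat.le_add_left 2 k

end RealVB

/-! ### Equivariant families as frames of the canonical bundle -/

namespace Conf

variable {X : Type u} {n : ℕ}

lemma fibreLinearEquiv_perm (x : Conf X n) {q : Unordered X n} (hx : x.toUnordered = q)
    (σ : Equiv.Perm (Fin n)) (hx' : (x.perm σ).toUnordered = q) (v : Fin n → ℝ) :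
    fibreLinearEquiv (x.perm σ) hx' (v ∘ σ) = fibreLinearEquiv x hx v :=
  fibreEquiv_perm x hx σ hx' v

lemma fibreLinearEquiv_symm_perm {x y : Conf X n} {σ : Equiv.Perm (Fin n)} (h : y = x.perm σ)
    {q : Unordered X n} (hx : x.toUnordered = q) (hy : y.toUnordered = q) (z : Fibre q) :
    (fibreLinearEquiv y hy).symm z = (fibreLinearEquiv x hx).symm z ∘ σ := by
  subst h
  rw [LinearEquiv.symm_apply_eq, fibreLinearEquiv_perm x hx, LinearEquiv.apply_symm_apply]

lemma toUnordered_perm (x : Conf X n) (σ : Equiv.Perm (Fin n)) :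
    (x.perm σ).toUnordered = x.toUnordered :=
  (toUnordered_eq.2 ⟨σ, rfl⟩).symm

variable [TopologicalSpace X]

lemma continuous_point {Y : Type*} [TopologicalSpace Y] {f : Y → Conf X n} {v : Y → Fin n → ℝ}
    (hf : Continuous f) (hv : Continuous v) : Continuous fun y => point (f y) (v y) := by
  rw [isInducing_total.continuous_iff]
  exact continuous_quotient_mk'.comp (hf.prodMk hv)

/-- An equivariant continuous family of vectors gives a continuous section. -/
lemma continuous_section {v : Conf X n → Fin n → ℝ} (hv : Continuous v)
    (h : ∀ x (σ : Equiv.Perm (Fin n)), v (x.perm σ) = v x ∘ σ) :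
    Continuous fun q : Unordered X n => (⟨q, fibreLinearEquiv q.out q.out_eq (v q.out)⟩ :
      TotalSpace (Fin n → ℝ) (Fibre (X := X) (n := n))) := by
  refine isQuotientMap_quot_mk.continuous_iff.2 ((continuous_point continuous_id hv).congr
    fun x => ?_)
  -- The chosen representative differs from `x` by some `σ`; equivariance of `v` absorbs it.
  obtain ⟨σ, hσ⟩ := toUnordered_eq.1
    (show x.toUnordered = toUnordered x.toUnordered.out from (Quotient.out_eq _).symm)
  refine TotalSpace.ext rfl (heq_of_eq ?_)
  change fibreLinearEquiv x rfl (v x) = fibreLinearEquiv x.toUnordered.out _ (v x.toUnordered.out)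
  have := fibreLinearEquiv_perm x rfl σ (x.toUnordered_perm σ) (v x)
  rw [← this, ← h]
  simp only [hσ]

variable [T2Space X]

theorem isTrivial_canonicalBundle {W : Type*} [NormedAddCommGroup W]
    [NormedSpace ℝ W] [FiniteDimensional ℝ W] (Φ : Conf X n → W ≃ₗ[ℝ] (Fin n → ℝ))
    (hΦ : ∀ w, Continuous fun x => Φ x w) (h : ∀ x (σ : Equiv.Perm (Fin n)) w, Φ (x.perm σ) w = Φ x w ∘ σ) :
    (canonicalBundle X n).IsTrivial :=
  RealVB.isTrivial_of_frame (canonicalBundle X n)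
    (fun q => (Φ q.out).trans (fibreLinearEquiv q.out q.out_eq))
    fun w => continuous_section (hΦ w) fun x σ => h x σ w

theorem isTrivial_whitneySum_canonicalBundle {W : Type*} [NormedAddCommGroup W]
    [NormedSpace ℝ W] [FiniteDimensional ℝ W]
    (Φ : Conf X n → W ≃ₗ[ℝ] (Fin n → ℝ) × (Fin n → ℝ))
    (hΦ : ∀ w, Continuous fun x => Φ x w)
    (h : ∀ x (σ : Equiv.Perm (Fin n)) w, Φ (x.perm σ) w = ((Φ x w).1 ∘ σ, (Φ x w).2 ∘ σ)) :
    (RealVB.whitneySum (canonicalBundle X n) (canonicalBundle X n)).IsTrivial :=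
  RealVB.isTrivial_of_frame _
    (fun q => (Φ q.out).trans (LinearEquiv.prodCongr (fibreLinearEquiv q.out q.out_eq)
      (fibreLinearEquiv q.out q.out_eq)))
    fun w => RealVB.continuous_whitneySum_iff.2
      ⟨continuous_section (v := fun x => (Φ x w).1) (continuous_fst.comp (hΦ w))
          fun x σ => congrArg Prod.fst (h x σ w),
        continuous_section (v := fun x => (Φ x w).2) (continuous_snd.comp (hΦ w))
          fun x σ => congrArg Prod.snd (h x σ w)⟩

end Conf

/-! ### Chebyshev systems on the circle -/

/-- For even `a + b`, the function `cosᵃ(t/2) sinᵇ(t/2)` of the point `exp (i t)` of the circle. -/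
def halfAngleMonomial (a b : ℕ) (z : Circle) : ℝ :=
  ((1 + (z : ℂ).re) / 2) ^ (a / 2) * ((1 - (z : ℂ).re) / 2) ^ (b / 2) * ((z : ℂ).im / 2) ^ (a % 2)

lemma continuous_halfAngleMonomial (a b : ℕ) : Continuous (halfAngleMonomial a b) := by
  have h1 : Continuous fun z : Circle => (z : ℂ).re :=
    Complex.continuous_re.comp continuous_subtype_val
  have h2 : Continuous fun z : Circle => (z : ℂ).im :=
    Complex.continuous_im.comp continuous_subtype_val
  unfold halfAngleMonomial
  fun_prop

lemma halfAngleMonomial_exp {a b : ℕ} (hab : Even (a + b)) (t : ℝ) :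
    halfAngleMonomial a b (Circle.exp t) = Real.cos (t / 2) ^ a * Real.sin (t / 2) ^ b := by
  have hre : (Circle.exp t : ℂ).re = Real.cos t := by
    rw [Circle.coe_exp, Complex.exp_ofReal_mul_I_re]
  have him : (Circle.exp t : ℂ).im = Real.sin t := by
    rw [Circle.coe_exp, Complex.exp_ofReal_mul_I_im]
  have e1 : (1 + Real.cos t) / 2 = Real.cos (t / 2) ^ 2 := by
    rw [Real.cos_sq, mul_div_cancel₀ t two_ne_zero]
    ring
  have e2 : (1 - Real.cos t) / 2 = Real.sin (t / 2) ^ 2 := by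
    rw [Real.sin_sq_eq_half_sub, mul_div_cancel₀ t two_ne_zero]
    ring
  have e3 : Real.sin t / 2 = Real.cos (t / 2) * Real.sin (t / 2) := by
    have := Real.sin_two_mul (t / 2)
    rw [mul_div_cancel₀ t two_ne_zero] at this
    rw [this]
    ring
  -- Equal parities leave the same exponent, 0 or 1, on cosine and sine after the squares are
  -- removed, so one factor of $\sin t/2$ accounts for both.
  have hm : b % 2 = a % 2 := by
    have := Nat.even_iff.1 hab
    omega
  rw [halfAngleMonomial, hre, him, e1, e2, e3, ← pow_mul, ← pow_mul, mul_pow]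
  conv_rhs => rw [← Nat.div_add_mod a 2, ← Nat.div_add_mod b 2, hm, pow_add, pow_add]
  ring

/-- The half-angle monomials of degree `n - 1`, for odd `n`, evaluated at `n` points. -/
def halfAngleMatrix {n : ℕ} (z : Fin n → Circle) : Matrix (Fin n) (Fin n) ℝ :=
  .of fun i j => halfAngleMonomial j j.rev (z i)

/-- The half-angle monomials of even degree form a Chebyshev system on the circle. -/
theorem det_halfAngleMatrix_ne_zero {n : ℕ} (hn : Odd n) {z : Fin n → Circle}
    (hz : Function.Injective z) : (halfAngleMatrix z).det ≠ 0 := by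
  choose t ht using fun i => Circle.exp_surjective (z i)
  have h : halfAngleMatrix z = Matrix.projVandermonde (fun i => Real.cos (t i / 2))
      (fun i => Real.sin (t i / 2)) := by
    ext i j
    -- The degree is $n-1$ in every column; this is where oddness of `n` enters.
    have he : Even ((j : ℕ) + j.rev) := by
      have := Nat.odd_iff.1 hn
      have := j.2
      rw [Nat.even_iff, Fin.val_rev]
      omega
    rw [Matrix.projVandermonde_apply, ← halfAngleMonomial_exp he, ht]
    rfl
  rw [h, Matrix.det_projVandermonde]
  refine Finset.prod_ne_zero_iff.2 fun i _ => Finset.prod_ne_zero_iff.2 fun j hj hij => ?_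
  -- Each factor of the determinant is the sine of half the difference of two angles, which vanishes
  -- only if the angles agree modulo $2\pi$.
  have h0 : Real.sin (t i / 2 - t j / 2) = 0 := by
    rw [Real.sin_sub]
    linarith
  obtain ⟨k, hk⟩ := Real.sin_eq_zero_iff.1 h0
  refine (Finset.mem_Ioi.1 hj).ne (hz ?_)
  rw [← ht i, ← ht j, Circle.exp_eq_exp]
  exact ⟨k, by linarith⟩

/-- Pairs of real vectors are complex vectors. -/
def complexVectorEquiv (n : ℕ) : (Fin n → ℂ) ≃ₗ[ℝ] (Fin n → ℝ) × (Fin n → ℝ) where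
  toFun v := (fun i => (v i).re, fun i => (v i).im)
  invFun p i := ⟨p.1 i, p.2 i⟩
  map_add' _ _ := rfl
  map_smul' r v := by ext <;> simp
  left_inv _ := rfl
  right_inv _ := rfl

/-! ### Triviality of the bundle for odd n and of its double for all n -/

namespace Conf

variable {X : Type u} {n : ℕ} [TopologicalSpace X]

lemma continuous_eval (i : Fin n) : Continuous fun x : Conf X n => x.1 i :=
  (continuous_apply i).comp continuous_subtype_val

variable [T2Space X]

theorem isTrivial_canonicalBundle_of_odd (h : X ≃ₜ Circle) (hn : Odd n) :
    (canonicalBundle X n).IsTrivial := by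
  have hdet : ∀ x : Conf X n, (Matrix.toLin' (halfAngleMatrix (h ∘ x.1))).det ≠ 0 := fun x => by
    rw [LinearMap.det_toLin']
    exact det_halfAngleMatrix_ne_zero hn (h.injective.comp x.2)
  refine isTrivial_canonicalBundle (fun x => LinearMap.equivOfDetNeZero _ (hdet x))
    (fun w => ?_) fun x σ w => rfl
  have key : Continuous fun x : Conf X n => (halfAngleMatrix (h ∘ x.1)).mulVec w :=
    Continuous.matrix_mulVec (continuous_matrix fun i j =>
      (continuous_halfAngleMonomial _ _).comp (h.continuous.comp (continuous_eval i)))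
      continuous_const
  exact key

/-- Complex Vandermonde matrices at distinct points are invertible; real and imaginary parts turn
the complex frame into a real frame of the double. -/
theorem isTrivial_whitneySum_canonicalBundle_of_circle (h : X ≃ₜ Circle) (n : ℕ) :
    (RealVB.whitneySum (canonicalBundle X n) (canonicalBundle X n)).IsTrivial := by
  have hdet : ∀ x : Conf X n,
      (Matrix.toLin' (Matrix.vandermonde fun i => (h (x.1 i) : ℂ))).det ≠ 0 := fun x => by
    rw [LinearMap.det_toLin', Matrix.det_vandermonde_ne_zero_iff]
    exact Subtype.val_injective.comp (h.injective.comp x.2)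
  refine isTrivial_whitneySum_canonicalBundle
    (fun x => ((LinearMap.equivOfDetNeZero _ (hdet x)).restrictScalars ℝ).trans
      (complexVectorEquiv n)) (fun w => ?_) fun x σ w => rfl
  have key : Continuous fun x : Conf X n =>
      (Matrix.vandermonde fun i => (h (x.1 i) : ℂ)).mulVec w :=
    Continuous.matrix_mulVec (continuous_matrix fun i j => (continuous_subtype_val.comp
      (h.continuous.comp (continuous_eval i))).pow _) continuous_const
  exact (continuous_pi fun i => Complex.continuous_re.comp (continuous_pi_iff.1 key i)).prodMk
    (continuous_pi fun i => Complex.continuous_im.comp (continuous_pi_iff.1 key i))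

end Conf

/-! ### Orientations and the rotation loop -/

namespace Conf

variable {X : Type u} {n : ℕ}

lemma det_funLeft (σ : Equiv.Perm (Fin n)) :
    (LinearMap.funLeft ℝ ℝ σ).det = ((Equiv.Perm.sign σ : ℤ) : ℝ) := by
  have : LinearMap.funLeft ℝ ℝ σ = Matrix.toLin' (σ.permMatrix ℝ) :=
    LinearMap.ext fun _ => (Matrix.permMatrix_mulVec σ).symm
  rw [this, LinearMap.det_toLin', Matrix.det_permutation]

lemma sign_cast_ne_zero (σ : Equiv.Perm (Fin n)) : ((Equiv.Perm.sign σ : ℤ) : ℝ) ≠ 0 :=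
  Int.cast_ne_zero.2 (Units.ne_zero _)

/-- The parity of a permutation, as an element of `ℤ/2`. -/
def parity (σ : Equiv.Perm (Fin n)) : ZMod 2 := signBit ((Equiv.Perm.sign σ : ℤ) : ℝ)

lemma parity_mul (σ τ : Equiv.Perm (Fin n)) : parity (σ * τ) = parity σ + parity τ := by
  unfold parity
  rw [← signBit_mul (sign_cast_ne_zero _) (sign_cast_ne_zero _), Equiv.Perm.sign_mul]
  push_cast
  rfl

lemma parity_finRotate_of_even (hn : 1 ≤ n) (h : Even n) : parity (finRotate n) = 1 := by
  have : Odd (n - 1) := Nat.Even.sub_odd hn h odd_one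
  rw [parity, sign_finRotate, this.neg_one_pow]
  simp [signBit]

variable [TopologicalSpace X]

/-- A locally constant function that changes under a permutation by its parity: an orientation
of the canonical bundle. -/
def IsOrientation (o : Conf X n → ZMod 2) : Prop :=
  (∀ x, ∀ᶠ y in 𝓝 x, o y = o x) ∧ ∀ x σ, o (x.perm σ) = o x + parity σ

lemma isOrientation_signBit {d : Conf X n → ℝ} (hd : Continuous d) (h0 : ∀ x, d x ≠ 0)
    (h : ∀ x σ, d (x.perm σ) * ((Equiv.Perm.sign σ : ℤ) : ℝ) = d x) :
    IsOrientation fun x => signBit (d x) := by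
  refine ⟨fun x => hd.continuousAt.eventually (signBit_locConst (h0 x)), fun x σ => ?_⟩
  change signBit (d (x.perm σ)) = signBit (d x) + parity σ
  rw [← h x σ, signBit_mul (h0 _) (sign_cast_ne_zero σ), parity, add_assoc,
    CharTwo.add_self_eq_zero, add_zero]

/-- Equally spaced points on the circle, rotated by `t / n` of a full turn. -/
def equallySpaced (h : X ≃ₜ Circle) (hn : 1 ≤ n) (t : ℝ) : Conf X n :=
  ⟨fun j => h.symm (Circle.exp (((j : ℕ) + t) / n * (2 * Real.pi))), fun j k hjk => by
    obtain ⟨m, hm⟩ := Circle.exp_eq_exp.1 (h.symm.injective hjk)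
    have hn' : (n : ℝ) ≠ 0 := by positivity
    have hpi := Real.pi_ne_zero
    have e : (j : ℝ) = (k : ℕ) + m * n := by
      field_simp at hm
      linarith
    have e' : ((j : ℕ) : ℤ) = (k : ℕ) + m * n := by exact_mod_cast e
    refine Fin.ext ?_
    have hj := j.2
    have hk := k.2
    -- Both indices lie in $[0,n)$ and agree modulo `n`.
    have h1 := congrArg (· % (n : ℤ)) e'
    simp only [Int.add_mul_emod_self_right] at h1
    rw [Int.emod_eq_of_lt (by omega) (by omega), Int.emod_eq_of_lt (by omega) (by omega)] at h1
    exact_mod_cast h1⟩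

lemma continuous_equallySpaced (h : X ≃ₜ Circle) (hn : 1 ≤ n) :
    Continuous (equallySpaced h hn) := by
  refine Continuous.subtype_mk (continuous_pi fun j => ?_) _
  exact h.symm.continuous.comp (Circle.exp.continuous.comp (by fun_prop))

lemma equallySpaced_one (h : X ≃ₜ Circle) (hn : 1 ≤ n) :
    equallySpaced h hn 1 = (equallySpaced h hn 0).perm (finRotate n) := by
  refine Subtype.ext (funext fun j => congrArg h.symm ?_)
  obtain ⟨m, rfl⟩ : ∃ m, n = m + 1 := ⟨n - 1, by omega⟩
  rw [coe_finRotate]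
  split_ifs with hj
  -- The last point has made a full turn past the first, hence the winding number 1.
  · rw [hj, Circle.exp_eq_exp]
    refine ⟨1, ?_⟩
    rw [Fin.val_last]
    push_cast
    field_simp
    ring
  · push_cast
    rw [add_zero]

/-- Along the path of equally spaced points an orientation is constant, yet its endpoints differ by
an odd cycle. -/
theorem not_isOrientation_of_even (h : X ≃ₜ Circle) (hn : 1 ≤ n) (he : Even n)
    (o : Conf X n → ZMod 2) : ¬ IsOrientation o := by
  rintro ⟨h1, h2⟩
  have hc : IsLocallyConstant fun t => o (equallySpaced h hn t) :=
    (IsLocallyConstant.iff_eventually_eq _).2 fun t =>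
      (continuous_equallySpaced h hn).continuousAt.eventually (h1 _)
  have := hc.apply_eq_of_preconnectedSpace 1 0
  rw [equallySpaced_one, h2, parity_finRotate_of_even hn he] at this
  simp at this

variable [T2Space X]

/-- The orientation is the sign of the determinant of the trivialized frame. Relabelling the points
changes this frame by a permutation matrix plus an identity block, whose determinant is the sign. -/
theorem exists_isOrientation_of_isStablyTrivial (h : (canonicalBundle X n).IsStablyTrivial) :
    ∃ o : Conf X n → ZMod 2, IsOrientation o := by
  obtain hX | ⟨⟨x₀⟩⟩ := isEmpty_or_nonempty (Conf X n)
  · exact ⟨0, fun x => isEmptyElim x, fun x => isEmptyElim x⟩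
  obtain ⟨j, m, φ, hφ, -⟩ := h
  let Ψ (x : Conf X n) : ((Fin n → ℝ) × (Fin j → ℝ)) ≃ₗ[ℝ] (Fin m → ℝ) :=
    (LinearEquiv.prodCongr (fibreLinearEquiv x rfl) (LinearEquiv.refl ℝ (Fin j → ℝ))).trans
      (φ x.toUnordered)
  have hΨ : ∀ p, Continuous fun x => Ψ x p := fun p => by
    refine (RealVB.continuous_trivial_iff.1 (hφ.comp (X := Conf X n)
      (f := fun x => ⟨x.toUnordered, (fibreLinearEquiv x rfl p.1, p.2)⟩) ?_)).2
    exact RealVB.continuous_whitneySum_iff.2 ⟨continuous_point continuous_id continuous_const,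
      RealVB.continuous_trivial_iff.2 ⟨continuous_toUnordered, continuous_const⟩⟩
  have hΨσ : ∀ x (σ : Equiv.Perm (Fin n)), (Ψ (x.perm σ)).toLinearMap.comp
      ((LinearMap.funLeft ℝ ℝ σ).prodMap LinearMap.id) = (Ψ x).toLinearMap := fun x σ => by
    -- The base points of `x` and `x.perm σ` agree only propositionally; with both generalized they
    -- can be identified by substitution.
    have key : ∀ {q q' : Unordered X n} (hq : x.toUnordered = q) (hq' : (x.perm σ).toUnordered = q')
        (p : (Fin n → ℝ) × (Fin j → ℝ)),
        φ q' (fibreLinearEquiv (x.perm σ) hq' (p.1 ∘ σ), p.2) =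
          φ q (fibreLinearEquiv x hq p.1, p.2) := by
      intro q q' hq hq' p
      obtain rfl : q = q' := by rw [← hq, ← hq', toUnordered_perm]
      rw [fibreLinearEquiv_perm x hq]
    exact LinearMap.ext fun p => key rfl rfl p
  -- Composing with the inverse frame at `x₀` yields endomorphisms of one space, whose determinants
  -- make sense.
  let D (x : Conf X n) : ((Fin n → ℝ) × (Fin j → ℝ)) →L[ℝ] ((Fin n → ℝ) × (Fin j → ℝ)) :=
    LinearMap.toContinuousLinearMap ((Ψ x₀).symm.toLinearMap.comp (Ψ x).toLinearMap)
  refine ⟨_, isOrientation_signBit (d := fun x => (D x).det)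
    (ContinuousLinearMap.continuous_det.comp (continuous_clm_apply.2 fun p => ?_))
    (fun x => ?_) fun x σ => ?_⟩
  · exact ((Ψ x₀).symm.toLinearMap.continuous_of_finiteDimensional).comp (hΨ p)
  · exact (LinearEquiv.isUnit_det' ((Ψ x).trans (Ψ x₀).symm)).ne_zero
  · change LinearMap.det _ * _ = LinearMap.det _
    simp only [D, LinearMap.coe_toContinuousLinearMap]
    rw [← hΨσ x σ, ← LinearMap.comp_assoc, LinearMap.det_comp, LinearMap.det_prodMap, det_funLeft,
      LinearMap.det_id, mul_one]

end Conf

/-! ### The first Stiefel–Whitney class as the obstruction to an orientation -/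

namespace Conf

variable {X : Type u} {n : ℕ}

lemma sec_mem {W : Set (Conf X n)} (hW : InjOn toUnordered W) {b : Unordered X n}
    (hb : b ∈ toUnordered '' W) : sec W b ∈ W := by
  obtain ⟨x, hx, rfl⟩ := hb
  rwa [sec_toUnordered hW hx]

variable [TopologicalSpace X]

/-- The section inverts the projection on the sheet, and the projection is open. -/
lemma continuousOn_sec {W : Set (Conf X n)} (hW : IsSheet W) :
    ContinuousOn (sec W) (toUnordered '' W) := by
  rintro _ ⟨x, hx, rfl⟩
  refine ContinuousAt.continuousWithinAt ?_
  rw [ContinuousAt, sec_toUnordered hW.2 hx]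
  intro N hN
  have h1 := isOpenMap_toUnordered.image_mem_nhds (Filter.inter_mem hN (hW.1.mem_nhds hx))
  refine Filter.mem_map.2 (Filter.mem_of_superset h1 ?_)
  rintro _ ⟨y, ⟨hyN, hyW⟩, rfl⟩
  rwa [mem_preimage, sec_toUnordered hW.2 hyW]

lemma isOpen_image_toUnordered {W : Set (Conf X n)} (hW : IsSheet W) :
    IsOpen (toUnordered '' W) :=
  isOpenMap_toUnordered W hW.1

/-- If a permutation relates the sections over two sheets at one point, then it does so nearby. -/
lemma eventually_sec_eq_perm {W W' : Set (Conf X n)} (hW : IsSheet W) (hW' : IsSheet W')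
    {b : Unordered X n} (hb : b ∈ toUnordered '' W) (hb' : b ∈ toUnordered '' W')
    {σ : Equiv.Perm (Fin n)} (h : sec W' b = (sec W b).perm σ) :
    ∀ᶠ c in 𝓝 b, sec W' c = (sec W c).perm σ := by
  have h1 : ContinuousAt (fun c => (sec W c).perm σ) b :=
    (continuous_perm σ).continuousAt.comp
      ((continuousOn_sec hW).continuousAt ((isOpen_image_toUnordered hW).mem_nhds hb))
  have h2 : W' ∈ 𝓝 ((sec W b).perm σ) := hW'.1.mem_nhds (h ▸ sec_mem hW'.2 hb')
  filter_upwards [h1 h2, (isOpen_image_toUnordered hW').mem_nhds hb'] with c hc hc'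
  refine hW'.2 (sec_mem hW'.2 hc') hc ?_
  rw [toUnordered_sec, toUnordered_perm, toUnordered_sec]

variable [T2Space X]

/-- The local section over the sheet used for the trivialization around `q`. -/
abbrev secAt (q : Unordered X n) : Unordered X n → Conf X n := sec (sheet q.out)

/-- The base set of the trivialization around `q`. -/
abbrev baseAt (q : Unordered X n) : Set (Unordered X n) := toUnordered '' sheet q.out

lemma mem_baseAt (q : Unordered X n) : q ∈ baseAt q := ⟨q.out, mem_sheet _, q.out_eq⟩

lemma isOpen_baseAt (q : Unordered X n) : IsOpen (baseAt q) :=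
  isOpen_image_toUnordered (isSheet_sheet _)

lemma continuousAt_secAt {q b : Unordered X n} (hb : b ∈ baseAt q) : ContinuousAt (secAt q) b :=
  (continuousOn_sec (isSheet_sheet _)).continuousAt ((isOpen_baseAt q).mem_nhds hb)

lemma detCocycle_canonicalBundle {q r b : Unordered X n} (hq : b ∈ baseAt q) (hr : b ∈ baseAt r)
    {σ : Equiv.Perm (Fin n)} (h : secAt r b = (secAt q b).perm σ) :
    (canonicalBundle X n).detCocycle q r b = parity σ := by
  have key : ((canonicalBundle X n).transition q r b).toLinearEquiv.toLinearMap =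
      LinearMap.funLeft ℝ ℝ σ := by
    refine LinearMap.ext fun v => ?_
    refine (Trivialization.coordChangeL_apply' (R := ℝ)
      (trivializationAt (Fin n → ℝ) (Fibre (X := X) (n := n)) q)
      (trivializationAt (Fin n → ℝ) (Fibre (X := X) (n := n)) r) ⟨hq, hr⟩ v).trans ?_
    change (fibreLinearEquiv (secAt r b) (toUnordered_sec _ b)).symm
      (fibreLinearEquiv (secAt q b) (toUnordered_sec _ b) v) = v ∘ σ
    exact (fibreLinearEquiv_symm_perm h _ _ _).trans
      (congrArg (· ∘ σ) (LinearEquiv.symm_apply_apply _ _))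
  change signBit (LinearMap.det _) = _
  rw [parity, ← det_funLeft, ← key]
  rfl

lemma stiefelWhitneyOne_eq_zero_iff {B : Type u} [TopologicalSpace B] (ξ : RealVB.{u, v, w} B) :
    ξ.stiefelWhitneyOne = 0 ↔ ξ.detCocycle ∈ Cech.coboundaries B (ZMod 2) := by
  rw [RealVB.stiefelWhitneyOne, QuotientAddGroup.eq_zero_iff, AddSubgroup.mem_addSubgroupOf]

lemma exists_secAt_perm (q : Unordered X n) (x : Conf X n) :
    ∃ σ, x = (secAt q x.toUnordered).perm σ :=
  toUnordered_eq.1 (toUnordered_sec _ _)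

/-- The determinant cocycle is the parity of the permutation relating two local sections. A
0-cochain bounding it prescribes an orientation on each local section, and the coboundary equation
says that these prescriptions agree. -/
theorem stiefelWhitneyOne_canonicalBundle_eq_zero_iff :
    (canonicalBundle X n).stiefelWhitneyOne = 0 ↔ ∃ o : Conf X n → ZMod 2, IsOrientation o := by
  rw [stiefelWhitneyOne_eq_zero_iff]
  constructor
  · rintro ⟨U, hU, h, h1, h2⟩
    choose s hs using fun x : Conf X n => exists_secAt_perm x.toUnordered x
    -- The value is defined with the chart at the class of `x` itself; the property recorded is that
    -- any other chart `q` computes the same value.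
    obtain ⟨o, ho⟩ : ∃ o : Conf X n → ZMod 2, ∀ x q τ, x.toUnordered ∈ U q →
        x.toUnordered ∈ baseAt q → x = (secAt q x.toUnordered).perm τ →
        o x = h q x.toUnordered + parity τ := by
      refine ⟨fun x => h x.toUnordered x.toUnordered + parity (s x), fun x q τ hx hx' hτ => ?_⟩
      obtain ⟨ρ, hρ⟩ := exists_secAt_perm q (secAt x.toUnordered x.toUnordered)
      rw [toUnordered_sec] at hρ
      have e1 := h2 q x.toUnordered x.toUnordered ⟨hx, (hU _).2⟩
      rw [detCocycle_canonicalBundle hx' (mem_baseAt _) hρ] at e1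
      have e2 : τ = ρ * s x := by
        refine perm_inj (hτ.symm.trans ((hs x).trans ?_))
        rw [hρ]
        rfl
      rw [e2, parity_mul, e1]
      ring
    refine ⟨o, fun x => ?_, fun x σ => ?_⟩
    · have hq := (hU x.toUnordered).2
      have hb := mem_baseAt x.toUnordered
      have hc : ContinuousAt (fun y : Conf X n => (secAt x.toUnordered y.toUnordered).perm (s x))
          x :=
        (continuous_perm _).continuousAt.comp
          (ContinuousAt.comp (continuousAt_secAt hb) continuous_toUnordered.continuousAt)
      -- Near `x` the same permutation `s x` carries the local section to `y`: both orderings lie in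
      -- one sheet, which holds at most one ordering of each configuration.
      have hn : sheet x ∈ 𝓝 ((secAt x.toUnordered x.toUnordered).perm (s x)) := by
        rw [← hs x]
        exact (isSheet_sheet x).1.mem_nhds (mem_sheet x)
      filter_upwards [hc hn, (isSheet_sheet x).1.mem_nhds (mem_sheet x),
        continuous_toUnordered.continuousAt ((hU x.toUnordered).1.mem_nhds hq),
        continuous_toUnordered.continuousAt ((isOpen_baseAt x.toUnordered).mem_nhds hb),
        continuous_toUnordered.continuousAt.eventually (h1 x.toUnordered _ hq)]
        with y hy1 hy2 hy3 hy4 hy5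
      rw [ho x _ _ hq hb (hs x), ho y _ (s x) hy3 hy4 ?_, hy5]
      refine (isSheet_sheet x).2 hy2 hy1 ?_
      rw [toUnordered_perm, toUnordered_sec]
    · rw [ho x _ _ (hU _).2 (mem_baseAt _) (hs x), add_assoc, ← parity_mul]
      have e := x.toUnordered_perm σ
      rw [ho (x.perm σ) x.toUnordered (s x * σ) (e ▸ (hU _).2) (e ▸ mem_baseAt _), e]
      rw [e]
      conv_lhs => rw [hs x]
      rfl
  · rintro ⟨o, ho1, ho2⟩
    refine ⟨baseAt, fun q => ⟨isOpen_baseAt q, mem_baseAt q⟩, fun q b => o (secAt q b),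
      fun q b hb => (continuousAt_secAt hb).eventually (ho1 _), fun q r b hb => ?_⟩
    obtain ⟨σ, hσ⟩ := exists_secAt_perm q (secAt r b)
    rw [toUnordered_sec] at hσ
    rw [detCocycle_canonicalBundle hb.1 hb.2 hσ]
    change parity σ = o (secAt r b) - o (secAt q b)
    rw [hσ, ho2]
    ring

end Conf

/-! ### Counterclockwise orderings -/

namespace Conf

variable {X : Type u} {n : ℕ} [TopologicalSpace X]

/-- The configurations in counterclockwise order. -/
def cyclicallyOrdered (h : X ≃ₜ Circle) (n : ℕ) : Set (Conf X n) :=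
  {x | ∃ t : Fin n → ℝ, (StrictMono t ∧ ∀ i j, t i < t j + 2 * Real.pi) ∧
    ∀ j, Circle.exp (t j) = h (x.1 j)}

/-- The admissible lifts are cut out by finitely many strict inequalities, and the coordinatewise
exponential is an open map. -/
lemma isOpen_cyclicallyOrdered (h : X ≃ₜ Circle) (n : ℕ) : IsOpen (cyclicallyOrdered h n) := by
  have h1 : IsOpen {t : Fin n → ℝ | StrictMono t ∧ ∀ i j, t i < t j + 2 * Real.pi} := by
    simp only [StrictMono, ofPred_and, ofPred_forall]
    refine IsOpen.inter ?_ ?_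
    · exact isOpen_iInter_of_finite fun i => isOpen_iInter_of_finite fun j =>
        isOpen_iInter_of_finite fun _ => isOpen_lt (continuous_apply i) (continuous_apply j)
    · exact isOpen_iInter_of_finite fun i => isOpen_iInter_of_finite fun j =>
        isOpen_lt (continuous_apply i) ((continuous_apply j).add continuous_const)
  have h2 : IsOpenMap (Pi.map fun (_ : Fin n) (t : ℝ) => Circle.exp t) :=
    IsOpenMap.piMap (fun _ => isLocalHomeomorph_circleExp.isOpenMap) (by simp)
  have h3 : Continuous fun (x : Conf X n) (j : Fin n) => h (x.1 j) :=
    continuous_pi fun j => h.continuous.comp (continuous_eval j)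
  convert! (h2 _ h1).preimage h3 using 1
  ext x
  simp only [cyclicallyOrdered, mem_ofPred_eq, mem_preimage, mem_image, funext_iff, Pi.map_apply]

/-- Sorting by the argument works, because arguments lie in $(-\pi,\pi]$ and so differ by less than
a full turn. -/
lemma exists_perm_mem_cyclicallyOrdered (h : X ≃ₜ Circle) (x : Conf X n) :
    ∃ σ, x.perm σ ∈ cyclicallyOrdered h n := by
  let t : Fin n → ℝ := fun j => (h (x.1 j) : ℂ).arg
  have ht : Function.Injective t := Circle.injective_arg.comp (h.injective.comp x.2)
  refine ⟨Tuple.sort t, t ∘ Tuple.sort t, ⟨?_, fun i j => ?_⟩, fun j => Circle.exp_arg _⟩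
  · exact (Tuple.monotone_sort t).strictMono_of_injective (ht.comp (Equiv.injective _))
  · have h1 := Complex.arg_le_pi (h (x.1 (Tuple.sort t i)))
    have h2 := Complex.neg_pi_lt_arg (h (x.1 (Tuple.sort t j)))
    simp only [Function.comp_apply, t]
    linarith

lemma perm_finRotate_mem_cyclicallyOrdered {h : X ≃ₜ Circle} {m : ℕ} {x : Conf X (m + 1)}
    (hx : x ∈ cyclicallyOrdered h (m + 1)) :
    x.perm (finRotate (m + 1)) ∈ cyclicallyOrdered h (m + 1) := by
  obtain ⟨t, ⟨h1, h2⟩, h3⟩ := hx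
  have e : ∀ i : Fin m, finRotate (m + 1) i.castSucc = i.succ := fun i => by
    rw [finRotate_apply, Fin.coeSucc_eq_succ]
  -- The new lift drops the first angle and appends it at the end, one turn later.
  refine ⟨Fin.snoc (α := fun _ => ℝ) (fun i : Fin m => t i.succ) (t 0 + 2 * Real.pi),
    ⟨fun i j hij => ?_, fun i j => ?_⟩, fun j => ?_⟩
  · induction i using Fin.lastCases with
    | last => exact absurd hij (Fin.le_last j).not_gt
    | cast i =>
      induction j using Fin.lastCases with
      | last =>
        simp only [Fin.snoc_castSucc, Fin.snoc_last]
        exact h2 _ _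
      | cast j =>
        simp only [Fin.snoc_castSucc]
        exact h1 (Fin.succ_lt_succ_iff.2 (Fin.castSucc_lt_castSucc_iff.1 hij))
  · have hpi := Real.pi_pos
    induction i using Fin.lastCases with
    | last =>
      induction j using Fin.lastCases with
      | last => simp only [Fin.snoc_last]; linarith
      | cast j =>
        have := h1 (Fin.succ_pos j)
        simp only [Fin.snoc_castSucc, Fin.snoc_last]
        linarith
    | cast i =>
      induction j using Fin.lastCases with
      | last =>
        have := h2 i.succ 0
        simp only [Fin.snoc_castSucc, Fin.snoc_last]
        linarith
      | cast j =>
        simp only [Fin.snoc_castSucc]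
        exact h2 _ _
  · induction j using Fin.lastCases with
    | last =>
      simp only [Fin.snoc_last]
      rw [Circle.exp_add_two_pi, h3]
      simp [perm]
    | cast j =>
      simp only [Fin.snoc_castSucc]
      rw [h3]
      simp only [perm, Function.comp_apply, e]

lemma perm_addRight_mem_cyclicallyOrdered {h : X ≃ₜ Circle} {m : ℕ} {x : Conf X (m + 1)}
    (hx : x ∈ cyclicallyOrdered h (m + 1)) (a : Fin (m + 1)) :
    x.perm (Equiv.addRight a) ∈ cyclicallyOrdered h (m + 1) := by
  induction a using Fin.induction with
  | zero =>
    rw [Equiv.addRight_zero]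
    exact hx
  | succ i ih =>
    convert! perm_finRotate_mem_cyclicallyOrdered ih using 1
    refine Subtype.ext (funext fun j => congrArg x.1 ?_)
    change j + i.succ = finRotate (m + 1) j + i.castSucc
    rw [finRotate_apply, ← Fin.coeSucc_eq_succ, add_comm i.castSucc, add_assoc]

/-- Lifts of the two orderings differ by whole turns. Each lift stays within one turn of its first
angle, and the first points coincide, so the number of turns is constant; hence `σ` is increasing
and must be the identity. -/
lemma eq_one_of_mem_cyclicallyOrdered {h : X ≃ₜ Circle} {m : ℕ} {x : Conf X (m + 1)}
    (hx : x ∈ cyclicallyOrdered h (m + 1)) {σ : Equiv.Perm (Fin (m + 1))}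
    (hσ : x.perm σ ∈ cyclicallyOrdered h (m + 1)) (h0 : σ 0 = 0) : σ = 1 := by
  obtain ⟨t, ⟨ht, ht'⟩, htx⟩ := hx
  obtain ⟨s, ⟨hs, hs'⟩, hsx⟩ := hσ
  have hpi := Real.pi_pos
  have h1 : ∀ j, ∃ k : ℤ, s j = t (σ j) + k * (2 * Real.pi) := fun j =>
    Circle.exp_eq_exp.1 ((hsx j).trans (htx (σ j)).symm)
  choose k hk using h1
  have hk0 : ∀ j, k j = k 0 := fun j => by
    have e1 := hk j
    have e2 := hk 0
    rw [h0] at e2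
    have h1 := hs.monotone (Fin.zero_le j)
    have h2 := ht.monotone (Fin.zero_le (σ j))
    have h3 := ht' (σ j) 0
    have h4 := hs' j 0
    have h5 : ((k j - k 0 : ℤ) : ℝ) * (2 * Real.pi) < 1 * (2 * Real.pi) := by
      push_cast; linarith
    have h6 : (-1 : ℝ) * (2 * Real.pi) < ((k j - k 0 : ℤ) : ℝ) * (2 * Real.pi) := by
      push_cast; linarith
    have h7 := lt_of_mul_lt_mul_right h5 (by positivity)
    have h8 := lt_of_mul_lt_mul_right h6 (by positivity)
    have h9 : k j - k 0 < 1 := by exact_mod_cast h7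
    have h10 : -1 < k j - k 0 := by exact_mod_cast h8
    omega
  have hmono : StrictMono σ := fun i j hij => by
    have := hs hij
    rw [hk i, hk j, hk0 i, hk0 j] at this
    exact ht.lt_iff_lt.1 (lt_of_add_lt_add_right this)
  refine Equiv.coe_fn_injective ((hmono.range_inj strictMono_id).1 ?_)
  rw [σ.surjective.range_eq, range_id]

/-- Undoing the rotation by `σ 0` reduces to a permutation that fixes 0. -/
lemma exists_addRight_of_mem_cyclicallyOrdered {h : X ≃ₜ Circle} {m : ℕ} {x : Conf X (m + 1)}
    (hx : x ∈ cyclicallyOrdered h (m + 1)) {σ : Equiv.Perm (Fin (m + 1))}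
    (hσ : x.perm σ ∈ cyclicallyOrdered h (m + 1)) : ∃ a, σ = Equiv.addRight a := by
  refine ⟨σ 0, ?_⟩
  have h1 := eq_one_of_mem_cyclicallyOrdered (σ := (Equiv.addRight (σ 0))⁻¹ * σ)
    (perm_addRight_mem_cyclicallyOrdered hx (σ 0)) ?_ ?_
  · rw [inv_mul_eq_one] at h1
    exact h1.symm
  · convert! hσ using 1
    refine Subtype.ext (funext fun j => congrArg x.1 ?_)
    exact (Equiv.addRight (σ 0)).apply_symm_apply (σ j)
  · rw [Equiv.Perm.mul_apply, Equiv.Perm.inv_eq_iff_eq]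
    exact (zero_add _).symm

/-! ### Reduction of the structure group from an open set of orderings -/

section Reduction

variable {G : Type*} [Group G] {i : G →* Equiv.Perm (Fin n)} {C : Set (Conf X n)}

lemma IsSheet.inter {W : Set (Conf X n)} (hW : IsSheet W) (hC : IsOpen C) : IsSheet (W ∩ C) :=
  ⟨hW.1.inter hC, hW.2.mono inter_subset_left⟩

variable [T2Space X]

lemma exists_mem_image_sheet_inter (h : ∀ x : Conf X n, ∃ σ, x.perm σ ∈ C) (b : Unordered X n) :
    ∃ x : Conf X n, b ∈ toUnordered '' (sheet x ∩ C) := by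
  obtain ⟨σ, hσ⟩ := h b.out
  exact ⟨_, _, ⟨mem_sheet _, hσ⟩, (toUnordered_perm _ σ).trans b.out_eq⟩

/-- An open set of orderings that meets each orbit in a coset of `G` gives a `G`-valued cocycle. -/
theorem exists_cocycle_of_isOpen (hi : Function.Injective i) (hC : IsOpen C)
    (h : ∀ x ∈ C, ∀ σ, x.perm σ ∈ C → ∃ g, σ = i g) :
    ∃ g : Conf X n → Conf X n → Unordered X n → G,
      (∀ x y, ∀ b ∈ toUnordered '' (sheet x ∩ C) ∩ toUnordered '' (sheet y ∩ C),
        sec (sheet y ∩ C) b = (sec (sheet x ∩ C) b).perm (i (g x y b))) ∧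
      (∀ x y, LocConstOn (g x y)
        (toUnordered '' (sheet x ∩ C) ∩ toUnordered '' (sheet y ∩ C))) ∧
      ∀ x y z, ∀ b ∈ toUnordered '' (sheet x ∩ C) ∩ toUnordered '' (sheet y ∩ C) ∩
        toUnordered '' (sheet z ∩ C), g x z b = g x y b * g y z b := by
  have hS := fun x : Conf X n => (isSheet_sheet x).inter hC
  have key : ∀ x y b, ∃ g : G,
      b ∈ toUnordered '' (sheet x ∩ C) ∩ toUnordered '' (sheet y ∩ C) →
        sec (sheet y ∩ C) b = (sec (sheet x ∩ C) b).perm (i g) := fun x y b => by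
    by_cases hb : b ∈ toUnordered '' (sheet x ∩ C) ∩ toUnordered '' (sheet y ∩ C)
    · obtain ⟨σ, hσ⟩ := toUnordered_eq.1
        ((toUnordered_sec (sheet x ∩ C) b).trans (toUnordered_sec (sheet y ∩ C) b).symm)
      obtain ⟨g, rfl⟩ := h _ (sec_mem (hS x).2 hb.1).2 σ (hσ ▸ (sec_mem (hS y).2 hb.2).2)
      exact ⟨g, fun _ => hσ⟩
    -- Off the overlap the value is irrelevant and is set to 1.
    · exact ⟨1, fun hb' => absurd hb' hb⟩
  choose g hg using key
  refine ⟨g, hg, fun x y b hb => ?_, fun x y z b hb => ?_⟩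
  · filter_upwards [eventually_sec_eq_perm (hS x) (hS y) hb.1 hb.2 (hg x y b hb),
      ((isOpen_image_toUnordered (hS x)).inter (isOpen_image_toUnordered (hS y))).mem_nhds hb]
      with c hc hc'
    -- The action is free and `i` is injective, so the group element is determined by the two
    -- sections; the cocycle identity below follows the same way.
    exact hi (perm_inj ((hg x y c hc').symm.trans hc))
  · refine hi (perm_inj ((hg x z b ⟨hb.1.1, hb.2⟩).symm.trans ?_))
    rw [hg y z b ⟨hb.1.2, hb.2⟩, hg x y b hb.1, map_mul]
    rfl

theorem coveringReducesTo_of_isOpen (hi : Function.Injective i) (hC : IsOpen C)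
    (h' : ∀ x : Conf X n, ∃ σ, x.perm σ ∈ C)
    (h : ∀ x ∈ C, ∀ σ, x.perm σ ∈ C → ∃ g, σ = i g) : CoveringReducesTo X n i := by
  obtain ⟨g, h1, h2, h3⟩ := exists_cocycle_of_isOpen hi hC h
  have hS := fun x : Conf X n => (isSheet_sheet x).inter hC
  exact ⟨Conf X n, fun x => toUnordered '' (sheet x ∩ C), fun x => sec (sheet x ∩ C), g,
    fun x => isOpen_image_toUnordered (hS x), exists_mem_image_sheet_inter h',
    fun x => ⟨continuousOn_sec (hS x), fun b _ => toUnordered_sec _ b⟩, h2, h3, h1⟩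

theorem structureGroupReducesTo_of_isOpen (hi : Function.Injective i) (hC : IsOpen C)
    (h' : ∀ x : Conf X n, ∃ σ, x.perm σ ∈ C)
    (h : ∀ x ∈ C, ∀ σ, x.perm σ ∈ C → ∃ g, σ = i g) :
    (canonicalBundle X n).StructureGroupReducesTo ((permRep n).comp i) := by
  obtain ⟨g, h1, h2, h3⟩ := exists_cocycle_of_isOpen hi hC h
  have hS := fun x : Conf X n => (isSheet_sheet x).inter hC
  refine ⟨Conf X n, fun x => sheetTriv (sheet x ∩ C) (hS x),
    fun x => inferInstanceAs ((sheetTriv (sheet x ∩ C) (hS x)).IsLinear ℝ), g,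
    exists_mem_image_sheet_inter h', h2, h3, fun x y b hb v => ?_⟩
  -- Coordinates in the ordering `y` are those in the ordering `x` precomposed with the permutation,
  -- so passing back from `y` to `x` uses its inverse, as `permRep` does.
  change (fibreLinearEquiv (sec (sheet x ∩ C) b) (toUnordered_sec _ b)).symm v =
    (fibreLinearEquiv (sec (sheet y ∩ C) b) (toUnordered_sec _ b)).symm v ∘
      ((i (g x y b))⁻¹ : Equiv.Perm (Fin n))
  refine Eq.symm ((congrArg (· ∘ ((i (g x y b))⁻¹ : Equiv.Perm (Fin n)))
    (fibreLinearEquiv_symm_perm (h1 x y b hb) (toUnordered_sec _ b) _ v)).trans ?_)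
  refine funext fun j => ?_
  simp

end Reduction

/-! ### The cyclic group of rotations -/

lemma addRight_add_eq_mul {m : ℕ} (a b : Fin (m + 1)) :
    Equiv.addRight (a + b) = Equiv.addRight a * Equiv.addRight b :=
  Equiv.ext fun j => show j + (a + b) = j + b + a by rw [add_assoc, add_comm a]

lemma addRight_injective {m : ℕ} :
    Function.Injective (Equiv.addRight : Fin (m + 1) → Equiv.Perm (Fin (m + 1))) := fun a b hab => by
  have : (0 : Fin (m + 1)) + a = 0 + b := Equiv.congr_fun hab 0
  rwa [zero_add, zero_add] at this

/-- The inclusion of `ℤ/(m + 1)` in the symmetric group by rotations. -/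
def rotationHom (m : ℕ) : Multiplicative (ZMod (m + 1)) →* Equiv.Perm (Fin (m + 1)) where
  toFun a := Equiv.addRight (show Fin (m + 1) from a.toAdd)
  map_one' := Equiv.addRight_zero
  map_mul' a b := addRight_add_eq_mul (show Fin (m + 1) from a.toAdd) b.toAdd

lemma rotationHom_injective (m : ℕ) : Function.Injective (rotationHom m) :=
  fun _ _ hab => addRight_injective hab

lemma rotationHom_one (m : ℕ) :
    rotationHom m (Multiplicative.ofAdd 1) = finRotate (m + 1) :=
  Equiv.ext fun j => (finRotate_apply j).symm

end Conf

end

/-! ### The main theorem -/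

theorem mainTheorem5 {Γ : Type u} [TopologicalSpace Γ] [T2Space Γ] (hΓ : Nonempty (Γ ≃ₜ Circle))
    (n : ℕ) (hn : 1 ≤ n) :
    ((Conf.canonicalBundle Γ n).stableOrder = (Conf.canonicalBundle Γ n).order ∧
      (Conf.canonicalBundle Γ n).order = if Odd n then 1 else 2) ∧
    (∃ i : Multiplicative (ZMod n) →* Equiv.Perm (Fin n),
      Function.Injective i ∧ i (Multiplicative.ofAdd 1) = finRotate n ∧
      Conf.CoveringReducesTo Γ n i ∧
      (Conf.canonicalBundle Γ n).StructureGroupReducesTo ((Conf.permRep n).comp i)) ∧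
    ((Conf.canonicalBundle Γ n).stiefelWhitneyOne ≠ 0 ↔ Even n) := by
  obtain ⟨h⟩ := hΓ
  refine ⟨?_, ?_, ?_⟩
  · by_cases ho : Odd n
    · have ht := Conf.isTrivial_canonicalBundle_of_odd h ho
      rw [if_pos ho, RealVB.order_eq_one ht, RealVB.stableOrder_eq_one ht.isStablyTrivial]
      exact ⟨rfl, rfl⟩
    · have hs : ¬ (Conf.canonicalBundle Γ n).IsStablyTrivial := fun hs => by
        obtain ⟨o, hO⟩ := Conf.exists_isOrientation_of_isStablyTrivial hs
        exact Conf.not_isOrientation_of_even h hn (Nat.not_odd_iff_even.1 ho) o hO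
      have h2 := Conf.isTrivial_whitneySum_canonicalBundle_of_circle h n
      rw [if_neg ho, RealVB.order_eq_two (fun ht => hs ht.isStablyTrivial) h2,
        RealVB.stableOrder_eq_two hs h2.isStablyTrivial]
      exact ⟨rfl, rfl⟩
  · obtain ⟨m, rfl⟩ : ∃ m, n = m + 1 := ⟨n - 1, by omega⟩
    have h1 : ∀ x ∈ Conf.cyclicallyOrdered h (m + 1), ∀ σ,
        x.perm σ ∈ Conf.cyclicallyOrdered h (m + 1) → ∃ g, σ = Conf.rotationHom m g :=
      fun x hx σ hσ => Conf.exists_addRight_of_mem_cyclicallyOrdered hx hσ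
    exact ⟨Conf.rotationHom m, Conf.rotationHom_injective m, Conf.rotationHom_one m,
      Conf.coveringReducesTo_of_isOpen (Conf.rotationHom_injective m)
        (Conf.isOpen_cyclicallyOrdered h _) (Conf.exists_perm_mem_cyclicallyOrdered h) h1,
      Conf.structureGroupReducesTo_of_isOpen (Conf.rotationHom_injective m)
        (Conf.isOpen_cyclicallyOrdered h _) (Conf.exists_perm_mem_cyclicallyOrdered h) h1⟩
  · rw [← Nat.not_odd_iff_even, Ne, Conf.stiefelWhitneyOne_canonicalBundle_eq_zero_iff, not_iff_not]
    refine ⟨fun ⟨o, hO⟩ => ?_, fun ho => ?_⟩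
    · by_contra ho
      exact Conf.not_isOrientation_of_even h hn (Nat.not_odd_iff_even.1 ho) o hO
    · exact Conf.exists_isOrientation_of_isStablyTrivial
        (Conf.isTrivial_canonicalBundle_of_odd h ho).isStablyTrivial
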